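/- Let $\nu,\mu\in\mathbb{N}_0$ with $\mu-\nu\in\mathbb{N}_0$, and let $n\ge 1$ be an integer. Let $J_\nu$ and $K_\nu$ be the Bessel function of the first kind and the modified Bessel function of the second kind. For $x>0$ put $$w_{\mu,\nu}(x)=\frac{K_\nu(\sqrt{x})}{2}\,x^{(\mu-1)/2}\ \text{ if }\mu-\nu\text{ is even},\qquad w_{\mu,\nu}(x)=\frac{K_\nu(\sqrt{x})}{2}\,x^{\mu/2}\ \text{ if }\mu-\nu\text{ is odd}.$$ Let $\phi_m$ ($m\ge 0$) be the monic polynomials, $\deg\phi_m=m$, that are orthogonal with respect to $w_{\mu,\nu}$ on $(0,\infty)$, let $\tau_m=\int_0^\infty w_{\mu,\nu}\phi_m^2\,dx$, let $x_1,\dots,x_n$ be the zeros of $\phi_n$, and let $w_j=\tau_{n-1}/(\phi_n'(x_j)\phi_{n-1}(x_j))$. Then the $x_j$ are $n$ distinct points of $(0,\infty)$, and they form with the $w_j$ the $n$-point Gaussian quadrature rule for $w_{\mu,\nu}$: $\int_0^\infty w_{\mu,\nu}(x)p(x)\,dx=\sum_{j=1}^n w_jp(x_j)$ for every polynomial $p$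 of degree at most $2n-1$. Let $\kappa=\mu$ if $\mu-\nu$ is even and $\kappa=\mu+1$ if $\mu-\nu$ is odd, and for $0\le k\le\mu-1$ let $$\hat w_k^0=\frac{1}{k!}\left(2^k\,\frac{\Gamma((\nu+k+1)/2)}{\Gamma((\nu-k+1)/2)}-\frac{2}{\pi}\cos\left(\frac{(k-\nu)\pi}{2}\right)\sum_{j=1}^n w_j\,x_j^{(k-\kappa)/2}\right),$$ where $1/\Gamma$ is $0$ at the poles of $\Gamma$. For $\omega>0$ and a complex function $f$ that is defined on the closed right half-plane and near $0$, is analytic in the open right half-plane and at $z=0$, and satisfies $|f(z)|\le C|z|^\sigma$ for some real $\sigma$ and $C$ and all $z$ in the open right half-plane with $|z|$ large enough, define the quadrature rule $$(Q_{2n,\mu}f)(\omega)=\frac1\omega\left(\sum_{k=0}^{\mu-1}\frac{\hat w_k^0}{\omega^k}f^{(k)}(0)+\sum_{j=1}^n\frac{w_j\,x_j^{-\kappa/2}}{\pi}\left[e^{-\nu\pi i/2}f\left(\frac{i\sqrt{x_j}}{\omega}\right)+e^{\nu\pi i/2}f\left(-\frac{i\sqrt{x_j}}{\omega}\right)\right]\right).$$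 Then this rule computes the Hankel transform exactly for polynomials, that is, $$\int_0^\infty f(x)J_\nu(\omega x)\,dx:=\lim_{s\to0^+}\int_0^\infty f(x)J_\nu(\omega x)e^{-sx}\,dx=(Q_{2n,\mu}f)(\omega)\quad\text{for all }\omega>0$$ (the integrals converge absolutely for each $s>0$ and the limit exists), whenever $f$ is, on the closed right half-plane, a complex polynomial of degree at most $4n+\mu-1$ and $\mu-\nu$ is even, or of degree at most $4n+\mu$ and $\mu-\nu$ is odd. -/

import Mathlib

open Set Filter Topology MeasureTheory
open scoped Polynomial

noncomputable section

namespace HankelRule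

/-- The Bessel function of the first kind `J_ν` of order `ν ∈ ℕ`, by its everywhere convergent
power series. -/
def besselJ (ν : ℕ) (x : ℝ) : ℝ :=
  ∑' m : ℕ, (-1) ^ m / ((m.factorial : ℝ) * ((m + ν).factorial : ℝ)) * (x / 2) ^ (2 * m + ν)

/-- The modified Bessel function of the second kind `K_ν(x)`, for `x > 0`:
`K_ν(x) = ∫_0^∞ exp(-x cosh t) cosh(ν t) dt`. -/
def besselK (ν x : ℝ) : ℝ :=
  ∫ t in Ioi (0 : ℝ), Real.exp (-x * Real.cosh t) * Real.cosh (ν * t)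

/-- `∫_0^∞ g(x) dx = L` in the sense of the Abel limit
`lim_{s → 0+} ∫_0^∞ g(x) exp(-s x) dx = L`, the regularised integrals being absolutely
convergent for every `s > 0`. -/
def HasAbelIntegral (g : ℝ → ℂ) (L : ℂ) : Prop :=
  (∀ s : ℝ, 0 < s → IntegrableOn (fun x : ℝ => g x * (Real.exp (-s * x) : ℂ)) (Ioi 0)) ∧
  Tendsto (fun s : ℝ => ∫ x in Ioi (0 : ℝ), g x * (Real.exp (-s * x) : ℂ)) (𝓝[>] 0) (𝓝 L)

/-- The (generalized Prudnikov) weight `w_{μ,ν}` on `(0, ∞)`, for `ν ≤ μ`. -/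
def weight (μ ν : ℕ) (x : ℝ) : ℝ :=
  besselK ν (Real.sqrt x) / 2 *
    (if Even (μ - ν) then x ^ (((μ : ℝ) - 1) / 2) else x ^ ((μ : ℝ) / 2))

/-- The bilinear form `∫_0^∞ W(x) p(x) q(x) dx` on real polynomials. -/
def weightedInner (W : ℝ → ℝ) (p q : ℝ[X]) : ℝ :=
  ∫ x in Ioi (0 : ℝ), W x * (p.eval x * q.eval x)

/-- The monic orthogonal polynomials `φ_n` with respect to `W` on `(0, ∞)`: the Gram–Schmidt
orthogonalisation of `1, X, X², …`, without normalisation. -/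
def orthoPoly (W : ℝ → ℝ) (n : ℕ) : ℝ[X] :=
  Polynomial.X ^ n - ∑ k : Fin n,
    Polynomial.C (weightedInner W (Polynomial.X ^ n) (orthoPoly W k) /
      weightedInner W (orthoPoly W k) (orthoPoly W k)) * orthoPoly W k
termination_by n
decreasing_by all_goals exact k.2

/-- The nodes of the `n`-point Gauss rule: the zeros of `φ_n`. -/
def gaussNodes (W : ℝ → ℝ) (n : ℕ) : Finset ℝ :=
  (orthoPoly W n).roots.toFinset

/-- The weight `τ_{n-1} / (φ_n'(x) φ_{n-1}(x))` of the `n`-point Gauss rule (`n ≥ 1`) at the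
node `x`, where `τ_m = ∫_0^∞ W φ_m²`. -/
def gaussWeight (W : ℝ → ℝ) (n : ℕ) (x : ℝ) : ℝ :=
  weightedInner W (orthoPoly W (n - 1)) (orthoPoly W (n - 1)) /
    ((orthoPoly W n).derivative.eval x * (orthoPoly W (n - 1)).eval x)

/-- `κ = μ` when `μ - ν` is even and `κ = μ + 1` when `μ - ν` is odd. -/
def kappa (μ ν : ℕ) : ℝ :=
  if Even (μ - ν) then (μ : ℝ) else (μ : ℝ) + 1

/-- The weight of the rule attached to the node `ε i √x`, for `ε = ± 1` and a Gauss node `x`: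
`exp(-ε ν π i / 2) w x^{-κ/2} / π`. -/
def interiorWeight (μ ν n : ℕ) (ε x : ℝ) : ℂ :=
  Complex.exp (-(ε : ℂ) * (ν : ℂ) * (Real.pi : ℂ) * Complex.I / 2) *
    ((gaussWeight (weight μ ν) n x * x ^ (-(kappa μ ν) / 2) / Real.pi : ℝ) : ℂ)

/-- The weight of the rule attached to the `k`-th derivative at the origin. At a pole of
`Γ((ν - k + 1)/2)` the quotient of Gamma values is `0`, since `Real.Gamma` is `0` there and
`a / 0 = 0`; this is the usual convention `1/Γ = 0`. -/
def boundaryWeight (μ ν n k : ℕ) : ℝ :=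
  1 / (k.factorial : ℝ) *
    (2 ^ k * (Real.Gamma (((ν : ℝ) + k + 1) / 2) / Real.Gamma (((ν : ℝ) - k + 1) / 2)) -
      2 / Real.pi * Real.cos (((k : ℝ) - ν) * Real.pi / 2) *
        ∑ x ∈ gaussNodes (weight μ ν) n,
          gaussWeight (weight μ ν) n x * x ^ (((k : ℝ) - kappa μ ν) / 2))

/-- The complex generalized Gauss–Radau rule `(Q_{2n,μ} f)(ω)` for the Hankel transform of
order `ν`. -/
def rule (μ ν n : ℕ) (f : ℂ → ℂ) (ω : ℝ) : ℂ :=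
  1 / (ω : ℂ) *
    (∑ k ∈ Finset.range μ, (boundaryWeight μ ν n k : ℂ) / (ω : ℂ) ^ k * iteratedDeriv k f 0 +
      ∑ x ∈ gaussNodes (weight μ ν) n,
        (interiorWeight μ ν n 1 x * f (Complex.I * (Real.sqrt x : ℂ) / (ω : ℂ)) +
          interiorWeight μ ν n (-1) x * f (-(Complex.I * (Real.sqrt x : ℂ)) / (ω : ℂ))))

end HankelRule

end

/-!
Exactness is checked on the monomials `x^k`, and there the Abel integral
`∫_0^∞ x^k J_ν(ω x) dx = ω^{-k-1} 2^k Γ((ν+k+1)/2) / Γ((ν-k+1)/2)` (`tendsto_besselLaplace`,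
`hasAbelIntegral_pow_mul_besselJ`) is compared with the rule. At `f = x^k` the two conjugate nodes
`± i √x_j / ω` add up to `ω^{-k} (2/π) cos((k-ν)π/2) w_j x_j^{(k-κ)/2}`
(`interiorWeight_mul_pow_add`). For `k < μ` the boundary weight is by definition the difference
between the moment and this sum. For `k ≥ μ` (`cos_mul_sum_gaussWeight`) there are two cases.
If `k - ν` is odd, the cosine vanishes and so does the moment, by a pole of `Γ`. If `k - ν` is
even, then `k = κ + 2m`, and for `k < 4n + κ` the degree `m` is at most `2n - 1`, so that the Gauss
rule gives `∑ w_j x_j^m = ∫ w_{μ,ν}(x) x^m dx = ∫_0^∞ t^k K_ν(t) dt`, the last step by `x = t²`.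
What remains is the identity `(2/π) cos((k-ν)π/2) ∫_0^∞ t^k K_ν(t) dt = ∫_0^∞ x^k J_ν(x) dx`
between moments (`integral_pow_mul_besselK_eq_besselMoment`).

All moments are found from recurrences. With `I_{k,ν}(s) = ∫_0^∞ x^k J_ν(x) e^{-sx} dx`, the
recurrences of the Bessel functions and integration by parts give
`(1 + s²) I_{k+1,ν} = (ν - k) I_{k,ν+1} + s (ν + k + 1) I_{k,ν}`, so the limits at `s → 0` reduce to
`k = 0`. These follow from `I_{0,0}(s) = 1 / √(1 + s²)`, which solves a first-order differential
equation (`sqrt_mul_besselLaplace_zero_zero`). For `K_ν`, Fubini turns the moment into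
`k! ∫_0^∞ cosh(νu) / cosh(u)^{k+1} du`; these numbers satisfy, up to sign, recurrences that hold
for the moments of `J_ν` too, and everything reduces to `∫_0^∞ du / cosh u = π / 2`.

The Gauss rule is proved for every positive weight on `(0, ∞)` with finite moments. Zeros that are
not real, simple and positive would give `φ_n` a factor of constant sign on `(0, ∞)`, against
orthogonality (`orthoPoly_ne_mul_of_nonneg`); the weights come from Lagrange interpolation at the
nodes (`eval_orthoPoly_mul_momentFunctional_div`).
-/

namespace HankelRule

/-! ### Gauss quadrature for a positive weight on the half-line -/

section Gauss

variable {W : ℝ → ℝ}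

/-- The moment functional `p ↦ ∫_0^∞ W p` of a weight with finite moments, as a linear form. -/
noncomputable def momentFunctional (W : ℝ → ℝ)
    (hint : ∀ p : ℝ[X], IntegrableOn (fun x => W x * p.eval x) (Ioi 0)) : ℝ[X] →ₗ[ℝ] ℝ where
  toFun p := ∫ x in Ioi (0 : ℝ), W x * p.eval x
  map_add' p q := by
    simp only [Polynomial.eval_add, mul_add]
    exact integral_add (hint p) (hint q)
  map_smul' c p := by
    simp only [Polynomial.eval_smul, smul_eq_mul, RingHom.id_apply]
    rw [← integral_const_mul]
    congr 1
    ext x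
    ring

lemma weightedInner_eq_momentFunctional
    (hint : ∀ p : ℝ[X], IntegrableOn (fun x => W x * p.eval x) (Ioi 0)) (p q : ℝ[X]) :
    weightedInner W p q = momentFunctional W hint (p * q) := by
  simp [weightedInner, momentFunctional]

lemma momentFunctional_pos
    (hint : ∀ p : ℝ[X], IntegrableOn (fun x => W x * p.eval x) (Ioi 0))
    (hpos : ∀ x, 0 < x → 0 < W x) {p : ℝ[X]} (hp : p ≠ 0)
    (hnn : ∀ x, 0 < x → 0 ≤ p.eval x) : 0 < momentFunctional W hint p := by
  change 0 < ∫ x in Ioi (0 : ℝ), W x * p.eval x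
  rw [setIntegral_pos_iff_support_of_nonneg_ae _ (hint p)]
  · have hsub : Ioi (0 : ℝ) \ (p.roots.toFinset : Set ℝ) ⊆
        Function.support (fun x => W x * p.eval x) ∩ Ioi 0 := by
      rintro x ⟨hx, hr⟩
      refine ⟨mul_ne_zero (hpos x hx).ne' fun h => hr ?_, hx⟩
      simp [hp, h]
    refine lt_of_lt_of_le ?_ (measure_mono hsub)
    rw [measure_sdiff_null (p.roots.toFinset.finite_toSet.measure_zero volume)]
    simp
  · filter_upwards [ae_restrict_mem measurableSet_Ioi] with x hx
    exact mul_nonneg (hpos x hx).le (hnn x hx)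

lemma orthoPoly_monic_natDegree (W : ℝ → ℝ) (n : ℕ) :
    (orthoPoly W n).Monic ∧ (orthoPoly W n).natDegree = n := by
  induction n using Nat.strong_induction_on with
  | _ n ih =>
    have hlt : (∑ k : Fin n, Polynomial.C (weightedInner W (Polynomial.X ^ n) (orthoPoly W k) /
        weightedInner W (orthoPoly W k) (orthoPoly W k)) * orthoPoly W k).degree < n := by
      rw [← Polynomial.mem_degreeLT]
      refine Submodule.sum_mem _ fun k _ => ?_
      rw [Polynomial.mem_degreeLT]
      refine lt_of_le_of_lt (Polynomial.degree_mul_le_of_le Polynomial.degree_C_le le_rfl) ?_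
      rw [zero_add, Polynomial.degree_eq_natDegree (ih k k.2).1.ne_zero, (ih k k.2).2]
      exact_mod_cast k.2
    have hm : (orthoPoly W n).Monic := by
      rw [orthoPoly]
      exact (Polynomial.monic_X_pow n).sub_of_left (by simpa using hlt)
    refine ⟨hm, ?_⟩
    rw [orthoPoly]
    refine Polynomial.natDegree_eq_of_degree_eq_some ?_
    rw [Polynomial.degree_sub_eq_left_of_degree_lt (by simpa using hlt), Polynomial.degree_X_pow]

lemma orthoPoly_monic (W : ℝ → ℝ) (n : ℕ) : (orthoPoly W n).Monic :=
  (orthoPoly_monic_natDegree W n).1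

lemma natDegree_orthoPoly (W : ℝ → ℝ) (n : ℕ) : (orthoPoly W n).natDegree = n :=
  (orthoPoly_monic_natDegree W n).2

lemma degree_orthoPoly (W : ℝ → ℝ) (n : ℕ) : (orthoPoly W n).degree = n := by
  rw [Polynomial.degree_eq_natDegree (orthoPoly_monic W n).ne_zero, natDegree_orthoPoly]

lemma momentFunctional_mul_self_pos
    (hint : ∀ p : ℝ[X], IntegrableOn (fun x => W x * p.eval x) (Ioi 0))
    (hpos : ∀ x, 0 < x → 0 < W x) {p : ℝ[X]} (hp : p ≠ 0) :
    0 < momentFunctional W hint (p * p) :=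
  momentFunctional_pos hint hpos (mul_ne_zero hp hp) fun x _ => by
    rw [Polynomial.eval_mul]
    exact mul_self_nonneg _

lemma momentFunctional_orthoPoly_mul_orthoPoly
    (hint : ∀ p : ℝ[X], IntegrableOn (fun x => W x * p.eval x) (Ioi 0))
    (hpos : ∀ x, 0 < x → 0 < W x) {m n : ℕ} (hmn : m < n) :
    momentFunctional W hint (orthoPoly W n * orthoPoly W m) = 0 := by
  induction n using Nat.strong_induction_on generalizing m with
  | _ n ih =>
    have key : ∀ k : Fin n, k ≠ ⟨m, hmn⟩ →
        momentFunctional W hint (orthoPoly W k * orthoPoly W m) = 0 := by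
      intro k hk
      rcases lt_or_gt_of_ne (fun h => hk (Fin.ext h) : (k : ℕ) ≠ m) with h | h
      · rw [mul_comm]
        exact ih m hmn h
      · exact ih k k.2 h
    have hne := (momentFunctional_mul_self_pos hint hpos (orthoPoly_monic W m).ne_zero).ne'
    rw [orthoPoly, sub_mul, map_sub, Finset.sum_mul, map_sum,
      Finset.sum_eq_single (⟨m, hmn⟩ : Fin n)]
    · simp only [weightedInner_eq_momentFunctional hint, ← Polynomial.smul_eq_C_mul,
        smul_mul_assoc, map_smul, smul_eq_mul]
      rw [div_mul_cancel₀ _ hne, sub_self]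
    · intro k _ hk
      rw [mul_assoc, ← Polynomial.smul_eq_C_mul, map_smul, key k hk, smul_zero]
    · simp

/-- Orthogonality to all polynomials of lower degree; the leading term of `q` is removed by a
multiple of `φ_d`, `d = deg q`. -/
lemma momentFunctional_orthoPoly_mul
    (hint : ∀ p : ℝ[X], IntegrableOn (fun x => W x * p.eval x) (Ioi 0))
    (hpos : ∀ x, 0 < x → 0 < W x) {n : ℕ} {p : ℝ[X]} (hp : p.degree < n) :
    momentFunctional W hint (orthoPoly W n * p) = 0 := by
  suffices h : ∀ d ≤ n, ∀ q : ℝ[X], q.degree < d →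
      momentFunctional W hint (orthoPoly W n * q) = 0 from h n le_rfl p hp
  intro d
  induction d with
  | zero =>
    intro _ q hq
    have : q = 0 := by simpa using hq
    simp [this]
  | succ d ih =>
    intro hd q hq
    have hr : (q - Polynomial.C (q.coeff d) * orthoPoly W d).degree < d := by
      rw [Polynomial.degree_lt_iff_coeff_zero]
      intro m hm
      rw [Polynomial.coeff_sub, Polynomial.coeff_C_mul]
      rcases hm.eq_or_lt with rfl | hm
      · have := (orthoPoly_monic W d).coeff_natDegree
        rw [natDegree_orthoPoly] at this
        rw [this, mul_one, sub_self]
      · rw [Polynomial.coeff_eq_zero_of_natDegree_lt (p := orthoPoly W d)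
          (by rwa [natDegree_orthoPoly]),
          (Polynomial.degree_lt_iff_coeff_zero _ _).1 hq m hm, mul_zero, sub_zero]
    have := ih (by omega) _ hr
    rwa [mul_sub, map_sub, mul_left_comm, ← Polynomial.smul_eq_C_mul, map_smul,
      momentFunctional_orthoPoly_mul_orthoPoly hint hpos (by omega), smul_zero, sub_zero] at this

/-- The one fact behind simplicity, reality and positivity of the zeros of `φ_n`: a proper
factor `g` of `φ_n = g r` cannot be nonnegative on `(0, ∞)`, for otherwise
`0 = ∫ W φ_n r = ∫ W g r² > 0`. -/
lemma orthoPoly_ne_mul_of_nonneg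
    (hint : ∀ p : ℝ[X], IntegrableOn (fun x => W x * p.eval x) (Ioi 0))
    (hpos : ∀ x, 0 < x → 0 < W x) {n : ℕ} {g r : ℝ[X]} (hg : 0 < g.natDegree)
    (hnn : ∀ x, 0 < x → 0 ≤ g.eval x) : orthoPoly W n ≠ g * r := by
  intro h
  have h0 : g * r ≠ 0 := h ▸ (orthoPoly_monic W n).ne_zero
  have hr0 : r ≠ 0 := right_ne_zero_of_mul h0
  have hdeg : r.degree < n := by
    have := natDegree_orthoPoly W n
    rw [h, Polynomial.natDegree_mul (left_ne_zero_of_mul h0) hr0] at this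
    rw [Polynomial.degree_eq_natDegree hr0]
    exact_mod_cast (by omega : r.natDegree < n)
  have hz := momentFunctional_orthoPoly_mul hint hpos hdeg
  refine (momentFunctional_pos hint hpos (mul_ne_zero h0 hr0) fun x hx => ?_).ne' (h ▸ hz)
  rw [mul_assoc, Polynomial.eval_mul, Polynomial.eval_mul]
  exact mul_nonneg (hnn x hx) (mul_self_nonneg _)

lemma card_roots_orthoPoly
    (hint : ∀ p : ℝ[X], IntegrableOn (fun x => W x * p.eval x) (Ioi 0))
    (hpos : ∀ x, 0 < x → 0 < W x) (n : ℕ) : (orthoPoly W n).roots.card = n := by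
  obtain ⟨q, hq, hcard, hroots⟩ := Polynomial.exists_prod_multiset_X_sub_C_mul (orthoPoly W n)
  rw [natDegree_orthoPoly] at hcard
  by_contra hne
  have hq0 : 0 < q.natDegree := by omega
  have hqne : q ≠ 0 := by
    rintro rfl
    simp at hq0
  have hnr : ∀ x, q.eval x ≠ 0 := fun x hx => by
    have : x ∈ q.roots := by simpa [hqne] using hx
    simp [hroots] at this
  -- `q` has no real zero, hence a constant sign.
  have hsign : (∀ x, 0 ≤ q.eval x) ∨ ∀ x, 0 ≤ (-q).eval x := by
    by_contra! hcon
    obtain ⟨⟨a, ha⟩, ⟨b, hb⟩⟩ := hcon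
    rw [Polynomial.eval_neg, neg_lt_zero] at hb
    obtain ⟨x, hx⟩ := mem_range_of_exists_le_of_exists_ge q.continuous ⟨a, ha.le⟩ ⟨b, hb.le⟩
    exact hnr x hx
  rcases hsign with h | h
  · exact orthoPoly_ne_mul_of_nonneg hint hpos hq0 (fun x _ => h x)
      (hq.symm.trans (mul_comm _ _))
  · exact orthoPoly_ne_mul_of_nonneg hint hpos (g := -q) (by simpa using hq0) (fun x _ => h x)
      (r := -(Multiset.map (fun a => Polynomial.X - Polynomial.C a)
        (orthoPoly W n).roots).prod) (by rw [neg_mul_neg, mul_comm, hq])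

lemma pos_of_mem_gaussNodes
    (hint : ∀ p : ℝ[X], IntegrableOn (fun x => W x * p.eval x) (Ioi 0))
    (hpos : ∀ x, 0 < x → 0 < W x) {n : ℕ} {a : ℝ} (ha : a ∈ gaussNodes W n) : 0 < a := by
  by_contra! hle
  have hroot : (orthoPoly W n).IsRoot a :=
    Polynomial.isRoot_of_mem_roots (Multiset.mem_toFinset.1 ha)
  obtain ⟨r, hr⟩ := Polynomial.dvd_iff_isRoot.2 hroot
  refine orthoPoly_ne_mul_of_nonneg hint hpos (by simp) (fun x hx => ?_) hr
  simp only [Polynomial.eval_sub, Polynomial.eval_X, Polynomial.eval_C]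
  linarith

lemma nodup_roots_orthoPoly
    (hint : ∀ p : ℝ[X], IntegrableOn (fun x => W x * p.eval x) (Ioi 0))
    (hpos : ∀ x, 0 < x → 0 < W x) (n : ℕ) : (orthoPoly W n).roots.Nodup := by
  rw [Multiset.nodup_iff_count_le_one]
  intro a
  by_contra! h
  rw [Polynomial.count_roots] at h
  obtain ⟨r, hr⟩ := (Polynomial.le_rootMultiplicity_iff (orthoPoly_monic W n).ne_zero).1 h
  refine orthoPoly_ne_mul_of_nonneg hint hpos (by simp) (fun x _ => ?_) hr
  simp only [Polynomial.eval_pow]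
  exact sq_nonneg _

lemma card_gaussNodes
    (hint : ∀ p : ℝ[X], IntegrableOn (fun x => W x * p.eval x) (Ioi 0))
    (hpos : ∀ x, 0 < x → 0 < W x) (n : ℕ) : (gaussNodes W n).card = n := by
  rw [gaussNodes, Multiset.toFinset_card_of_nodup (nodup_roots_orthoPoly hint hpos n),
    card_roots_orthoPoly hint hpos]

lemma nodal_gaussNodes
    (hint : ∀ p : ℝ[X], IntegrableOn (fun x => W x * p.eval x) (Ioi 0))
    (hpos : ∀ x, 0 < x → 0 < W x) (n : ℕ) :
    Lagrange.nodal (gaussNodes W n) id = orthoPoly W n := by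
  have hprod := Polynomial.prod_multiset_X_sub_C_of_monic_of_roots_card_eq (orthoPoly_monic W n)
    (by rw [card_roots_orthoPoly hint hpos, natDegree_orthoPoly])
  rw [Lagrange.nodal_eq, gaussNodes, Finset.prod_eq_multiset_prod, Multiset.toFinset_val,
    (nodup_roots_orthoPoly hint hpos n).dedup]
  exact hprod

/-- The integral `∫ W φ_n / (x - a)` at a node `a`. Both sides come from evaluating
`∫ W g φ_{n-1}`, `g = φ_n / (x - a)`: as `g` is monic of degree `n - 1` this is `τ_{n-1}`, and as
`(x - a) g = φ_n` is orthogonal to lower degrees, `φ_{n-1}` may be replaced by `φ_{n-1}(a)`. -/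
lemma eval_orthoPoly_mul_momentFunctional_div
    (hint : ∀ p : ℝ[X], IntegrableOn (fun x => W x * p.eval x) (Ioi 0))
    (hpos : ∀ x, 0 < x → 0 < W x) {n : ℕ} (hn : 1 ≤ n) {a : ℝ} {g : ℝ[X]}
    (hg : orthoPoly W n = (Polynomial.X - Polynomial.C a) * g) :
    (orthoPoly W (n - 1)).eval a * momentFunctional W hint g =
      momentFunctional W hint (orthoPoly W (n - 1) * orthoPoly W (n - 1)) := by
  have hgm : g.Monic := (Polynomial.monic_X_sub_C a).of_mul_monic_left (hg ▸ orthoPoly_monic W n)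
  have hgd : g.natDegree = n - 1 := by
    have := natDegree_orthoPoly W n
    rw [hg, (Polynomial.monic_X_sub_C a).natDegree_mul hgm, Polynomial.natDegree_X_sub_C] at this
    omega
  have h1 : momentFunctional W hint (orthoPoly W (n - 1) * (g - orthoPoly W (n - 1))) = 0 := by
    refine momentFunctional_orthoPoly_mul hint hpos ?_
    have hdg : g.degree = ((n - 1 : ℕ) : WithBot ℕ) := by
      rw [Polynomial.degree_eq_natDegree hgm.ne_zero, hgd]
    rw [← hdg]
    exact Polynomial.degree_sub_lt_left (by rw [hdg, degree_orthoPoly]) hgm.ne_zero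
      (hgm.leadingCoeff.trans (orthoPoly_monic W _).leadingCoeff.symm)
  obtain ⟨h, hh⟩ := Polynomial.X_sub_C_dvd_sub_C_eval (p := orthoPoly W (n - 1)) (a := a)
  have h2 : momentFunctional W hint (orthoPoly W n * h) = 0 := by
    refine momentFunctional_orthoPoly_mul hint hpos ?_
    by_cases h0 : h = 0
    · rw [h0, Polynomial.degree_zero]
      exact WithBot.bot_lt_coe n
    rw [Polynomial.degree_eq_natDegree h0]
    have hd := congrArg Polynomial.natDegree hh
    rw [Polynomial.natDegree_sub_C, natDegree_orthoPoly,
      Polynomial.natDegree_mul (Polynomial.X_sub_C_ne_zero a) h0,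
      Polynomial.natDegree_X_sub_C] at hd
    exact_mod_cast (by omega : h.natDegree < n)
  rw [mul_sub, map_sub, sub_eq_zero] at h1
  rw [← h1, sub_eq_iff_eq_add.1 hh, add_mul, map_add, mul_right_comm, ← hg, h2, zero_add,
    ← Polynomial.smul_eq_C_mul, map_smul, smul_eq_mul]
  simp

/-- Exactness of the `n`-point Gauss rule in degrees below `2n`. -/
lemma momentFunctional_eq_sum_gaussWeight
    (hint : ∀ p : ℝ[X], IntegrableOn (fun x => W x * p.eval x) (Ioi 0))
    (hpos : ∀ x, 0 < x → 0 < W x) {n : ℕ} (hn : 1 ≤ n) {p : ℝ[X]}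
    (hp : p.natDegree ≤ 2 * n - 1) :
    momentFunctional W hint p = ∑ a ∈ gaussNodes W n, gaussWeight W n a * p.eval a := by
  have hmon := orthoPoly_monic W n
  have hnod := nodal_gaussNodes hint hpos n
  have hroot : ∀ a ∈ gaussNodes W n, (orthoPoly W n).eval a = 0 := fun a ha =>
    Polynomial.isRoot_of_mem_roots (Multiset.mem_toFinset.1 ha)
  have hdiv := Polynomial.modByMonic_add_div p (orthoPoly W n)
  have hq : momentFunctional W hint (orthoPoly W n * (p /ₘ orthoPoly W n)) = 0 := by
    refine momentFunctional_orthoPoly_mul hint hpos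
      (lt_of_le_of_lt Polynomial.degree_le_natDegree ?_)
    rw [Polynomial.natDegree_divByMonic _ hmon, natDegree_orthoPoly]
    exact_mod_cast (by omega : p.natDegree - n < n)
  have heval : ∀ a ∈ gaussNodes W n, (p %ₘ orthoPoly W n).eval a = p.eval a := fun a ha => by
    conv_rhs => rw [← hdiv]
    simp [hroot a ha]
  have hr : p %ₘ orthoPoly W n =
      Lagrange.interpolate (gaussNodes W n) id fun a => p.eval a := by
    refine Lagrange.eq_interpolate_of_eval_eq _ (injOn_id _) ?_ heval
    rw [card_gaussNodes hint hpos, ← degree_orthoPoly W n]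
    exact Polynomial.degree_modByMonic_lt _ hmon
  conv_lhs => rw [← hdiv, map_add, hq, add_zero, hr,
    Lagrange.interpolate_eq_nodalWeight_mul_nodal_div_X_sub_C, map_sum]
  refine Finset.sum_congr rfl fun a ha => ?_
  have hg : orthoPoly W n =
      (Polynomial.X - Polynomial.C a) * (orthoPoly W n / (Polynomial.X - Polynomial.C a)) :=
    (EuclideanDomain.mul_div_cancel' (Polynomial.X_sub_C_ne_zero a)
      (Polynomial.dvd_iff_isRoot.2 (hroot a ha))).symm
  have hτ := eval_orthoPoly_mul_momentFunctional_div hint hpos hn hg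
  have hne : (orthoPoly W (n - 1)).eval a ≠ 0 := fun h0 => by
    rw [h0, zero_mul] at hτ
    exact (momentFunctional_mul_self_pos hint hpos (orthoPoly_monic W _).ne_zero).ne hτ
  rw [Lagrange.nodalWeight_eq_eval_derivative_nodal ha, hnod, id, mul_right_comm,
    ← Polynomial.C_mul, ← Polynomial.smul_eq_C_mul, map_smul, smul_eq_mul, gaussWeight,
    weightedInner_eq_momentFunctional hint, ← hτ]
  field_simp

end Gauss

/-! ### Bessel functions of the first kind -/

/-- The entire function `C_ν(y) = ∑ (-1)^m y^m / (m! (m + ν)!)`, for which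
`J_ν(x) = (x/2)^ν C_ν((x/2)²)`. -/
noncomputable def besselClifford (ν : ℕ) (y : ℝ) : ℝ :=
  ∑' m : ℕ, (-1) ^ m / ((m.factorial : ℝ) * ((m + ν).factorial : ℝ)) * y ^ m

lemma summable_besselClifford (ν : ℕ) (y : ℝ) :
    Summable fun m : ℕ => (-1) ^ m / ((m.factorial : ℝ) * ((m + ν).factorial : ℝ)) * y ^ m := by
  refine Summable.of_norm_bounded (Real.summable_pow_div_factorial |y|) fun m => ?_
  rw [norm_mul, norm_div, norm_pow, norm_neg, norm_one, one_pow, norm_mul, norm_pow,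
    Real.norm_natCast, Real.norm_natCast, Real.norm_eq_abs, one_div_mul_eq_div]
  have : (1 : ℝ) ≤ ((m + ν).factorial : ℝ) := by exact_mod_cast Nat.factorial_pos _
  gcongr
  exact le_mul_of_one_le_right (by positivity) this

lemma hasDerivAt_besselClifford (ν : ℕ) (y : ℝ) :
    HasDerivAt (besselClifford ν) (-besselClifford (ν + 1) y) y := by
  set R := |y| + 1 with hR
  have hu : Summable fun m : ℕ => (m : ℝ) * R ^ (m - 1) / m.factorial := by
    rw [← summable_nat_add_iff 1]
    refine (Real.summable_pow_div_factorial R).congr fun m => ?_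
    rw [Nat.factorial_succ, Nat.add_sub_cancel]
    push_cast
    field_simp
  have hy : y ∈ Metric.ball (0 : ℝ) R := by simp [hR]
  have key := hasDerivAt_tsum_of_isPreconnected hu Metric.isOpen_ball
    (convex_ball (0 : ℝ) R).isPreconnected
    (g := fun m y => (-1) ^ m / ((m.factorial : ℝ) * ((m + ν).factorial : ℝ)) * y ^ m)
    (g' := fun m y => (-1) ^ m / ((m.factorial : ℝ) * ((m + ν).factorial : ℝ)) *
      (m * y ^ (m - 1)))
    (fun m z _ => (hasDerivAt_pow m z).const_mul _) (fun m z hz => ?_) hy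
    (summable_besselClifford ν y) hy
  · convert! key using 1
    have hs : Summable fun m : ℕ => (-1) ^ m / ((m.factorial : ℝ) * ((m + ν).factorial : ℝ)) *
        (m * y ^ (m - 1)) := by
      rw [← summable_nat_add_iff 1]
      refine (summable_besselClifford (ν + 1) y).neg.congr fun m => ?_
      rw [Nat.factorial_succ, Nat.add_sub_cancel, show m + 1 + ν = m + (ν + 1) by ring]
      push_cast
      field_simp
      ring
    rw [hs.tsum_eq_zero_add, besselClifford, ← tsum_neg]
    simp only [CharP.cast_eq_zero, zero_mul, mul_zero, zero_add]
    congr 1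
    ext m
    rw [Nat.factorial_succ, Nat.add_sub_cancel, show m + 1 + ν = m + (ν + 1) by ring]
    push_cast
    field_simp
    ring
  · have hz' : |z| ≤ R := by
      rw [mem_ball_zero_iff, Real.norm_eq_abs] at hz
      exact hz.le
    rw [norm_mul, norm_div, norm_pow, norm_neg, norm_one, one_pow, norm_mul, norm_mul, norm_pow,
      Real.norm_natCast, Real.norm_natCast, Real.norm_natCast, Real.norm_eq_abs,
      one_div_mul_eq_div]
    have : (1 : ℝ) ≤ ((m + ν).factorial : ℝ) := by exact_mod_cast Nat.factorial_pos _
    gcongr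
    exact le_mul_of_one_le_right (by positivity) this

lemma besselClifford_recurrence (ν : ℕ) (y : ℝ) :
    besselClifford ν y = (ν + 1) * besselClifford (ν + 1) y - y * besselClifford (ν + 2) y := by
  rw [sub_eq_add_neg, ← sub_eq_iff_eq_add']
  simp only [besselClifford]
  rw [← tsum_mul_left, ← tsum_mul_left,
    ← (summable_besselClifford ν y).tsum_sub ((summable_besselClifford (ν + 1) y).mul_left _),
    ((summable_besselClifford ν y).sub
      ((summable_besselClifford (ν + 1) y).mul_left _)).tsum_eq_zero_add, ← tsum_neg]
  have h0 : (-1 : ℝ) ^ 0 / ((Nat.factorial 0 : ℝ) * ((0 + ν).factorial : ℝ)) * y ^ 0 -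
      (ν + 1) * ((-1) ^ 0 / ((Nat.factorial 0 : ℝ) * ((0 + (ν + 1)).factorial : ℝ)) * y ^ 0) =
      0 := by
    simp only [zero_add, Nat.factorial_succ ν]
    push_cast
    field_simp
    simp
  rw [h0, zero_add]
  congr 1
  ext m
  rw [show m + (ν + 2) = m + ν + 1 + 1 by ring, show m + 1 + (ν + 1) = m + ν + 1 + 1 by ring,
    show m + 1 + ν = m + ν + 1 by ring, Nat.factorial_succ (m + ν + 1), Nat.factorial_succ m]
  push_cast
  field_simp
  ring

lemma besselJ_eq (ν : ℕ) (x : ℝ) :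
    besselJ ν x = (x / 2) ^ ν * besselClifford ν ((x / 2) ^ 2) := by
  rw [besselJ, besselClifford, ← tsum_mul_left]
  congr 1
  ext m
  rw [pow_add, pow_mul]
  ring

lemma besselJ_zero_zero : besselJ 0 0 = 1 := by
  rw [besselJ_eq, besselClifford, tsum_eq_single 0]
  · simp
  · intro m hm
    simp [hm]

lemma besselJ_succ_zero (ν : ℕ) : besselJ (ν + 1) 0 = 0 := by
  simp [besselJ_eq]

lemma mul_besselJ_add_besselJ (ν : ℕ) (x : ℝ) :
    x * (besselJ ν x + besselJ (ν + 2) x) = 2 * (ν + 1) * besselJ (ν + 1) x := by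
  simp only [besselJ_eq]
  rw [besselClifford_recurrence ν]
  ring

lemma hasDerivAt_besselClifford_comp (ν : ℕ) (x : ℝ) :
    HasDerivAt (fun x => besselClifford ν ((x / 2) ^ 2))
      (-besselClifford (ν + 1) ((x / 2) ^ 2) * (x / 2)) x := by
  have h := (((hasDerivAt_id x).div_const 2).pow 2)
  refine ((hasDerivAt_besselClifford ν _).comp x h).congr_deriv ?_
  simp only [id, Pi.pow_apply]
  ring

lemma hasDerivAt_besselJ_zero (x : ℝ) : HasDerivAt (besselJ 0) (-besselJ 1 x) x := by
  have h : besselJ 0 = fun x => besselClifford 0 ((x / 2) ^ 2) := by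
    ext x
    simp [besselJ_eq]
  rw [h]
  refine (hasDerivAt_besselClifford_comp 0 x).congr_deriv ?_
  rw [besselJ_eq]
  ring

lemma hasDerivAt_besselJ_succ (ν : ℕ) (x : ℝ) :
    HasDerivAt (besselJ (ν + 1)) ((besselJ ν x - besselJ (ν + 2) x) / 2) x := by
  have h : besselJ (ν + 1) = fun x => (x / 2) ^ (ν + 1) * besselClifford (ν + 1) ((x / 2) ^ 2) := by
    ext x
    exact besselJ_eq _ _
  rw [h]
  refine ((((hasDerivAt_id x).div_const 2).pow (ν + 1)).mul
    (hasDerivAt_besselClifford_comp (ν + 1) x)).congr_deriv ?_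
  simp only [besselJ_eq]
  rw [besselClifford_recurrence ν]
  simp only [Pi.pow_apply, id, Nat.add_sub_cancel]
  push_cast
  ring

lemma differentiable_besselJ (ν : ℕ) : Differentiable ℝ (besselJ ν) := fun x => by
  cases ν with
  | zero => exact (hasDerivAt_besselJ_zero x).differentiableAt
  | succ ν => exact (hasDerivAt_besselJ_succ ν x).differentiableAt

lemma continuous_besselJ (ν : ℕ) : Continuous (besselJ ν) :=
  (differentiable_besselJ ν).continuous

lemma mul_deriv_besselJ (ν : ℕ) (x : ℝ) :
    x * deriv (besselJ ν) x = ν * besselJ ν x - x * besselJ (ν + 1) x := by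
  cases ν with
  | zero =>
    rw [(hasDerivAt_besselJ_zero x).deriv]
    simp
  | succ ν =>
    rw [(hasDerivAt_besselJ_succ ν x).deriv]
    push_cast
    linear_combination mul_besselJ_add_besselJ ν x / 2

/-- `J_0² + J_1²` has derivative `-2 J_1² / x` and so stays below its value `1` at the origin. -/
lemma besselJ_zero_sq_add_besselJ_one_sq_le {x : ℝ} (hx : 0 ≤ x) :
    besselJ 0 x ^ 2 + besselJ 1 x ^ 2 ≤ 1 := by
  have hd : ∀ x, HasDerivAt (fun x => besselJ 0 x ^ 2 + besselJ 1 x ^ 2)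
      (-besselJ 1 x * (besselJ 0 x + besselJ 2 x)) x := fun x => by
    refine (((hasDerivAt_besselJ_zero x).pow 2).add
      ((hasDerivAt_besselJ_succ 0 x).pow 2)).congr_deriv ?_
    push_cast
    ring
  have hanti : AntitoneOn (fun x => besselJ 0 x ^ 2 + besselJ 1 x ^ 2) (Ici 0) := by
    refine antitoneOn_of_deriv_nonpos (convex_Ici 0)
      (fun x _ => (hd x).continuousAt.continuousWithinAt)
      (fun x _ => (hd x).differentiableAt.differentiableWithinAt) fun x hx => ?_
    rw [interior_Ici, mem_Ioi] at hx
    rw [(hd x).deriv]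
    have hrec := mul_besselJ_add_besselJ 0 x
    refine nonpos_of_mul_nonpos_right (a := x) ?_ hx
    have : x * (-besselJ 1 x * (besselJ 0 x + besselJ 2 x)) = -2 * besselJ 1 x ^ 2 := by
      push_cast at hrec
      linear_combination (-besselJ 1 x) * hrec
    rw [this]
    nlinarith [sq_nonneg (besselJ 1 x)]
  have := hanti (mem_Ici.2 le_rfl) (mem_Ici.2 hx) hx
  simpa [besselJ_zero_zero, besselJ_succ_zero 0] using this

lemma exists_abs_besselJ_le (ν : ℕ) : ∃ C, ∀ x, 0 ≤ x → |besselJ ν x| ≤ C := by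
  suffices h : ∀ ν, (∃ C, ∀ x, 0 ≤ x → |besselJ ν x| ≤ C) ∧
      ∃ C, ∀ x, 0 ≤ x → |besselJ (ν + 1) x| ≤ C from (h ν).1
  intro ν
  induction ν with
  | zero =>
    refine ⟨⟨1, fun x hx => ?_⟩, ⟨1, fun x hx => ?_⟩⟩ <;>
    · have := besselJ_zero_sq_add_besselJ_one_sq_le hx
      rw [← sq_le_one_iff_abs_le_one]
      nlinarith [sq_nonneg (besselJ 0 x), sq_nonneg (besselJ 1 x)]
  | succ ν ih =>
    refine ⟨ih.2, ?_⟩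
    obtain ⟨⟨C, hC⟩, ⟨D, hD⟩⟩ := ih
    obtain ⟨B, hB⟩ := isCompact_Icc.exists_bound_of_continuousOn
      (continuous_besselJ (ν + 2)).continuousOn (s := Icc (0 : ℝ) 1)
    refine ⟨max B (2 * (ν + 1) * D + C), fun x hx => ?_⟩
    rcases le_total x 1 with h1 | h1
    · exact (hB x ⟨hx, h1⟩).trans (le_max_left _ _)
    · refine le_max_of_le_right ?_
      have hx0 : 0 < x := by linarith
      have hrec : besselJ (ν + 2) x = 2 * (ν + 1) * besselJ (ν + 1) x / x - besselJ ν x := by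
        rw [eq_sub_iff_add_eq, eq_div_iff hx0.ne']
        linear_combination mul_besselJ_add_besselJ ν x
      rw [show ν + 1 + 1 = ν + 2 from rfl, hrec]
      refine (abs_sub _ _).trans (add_le_add ?_ (hC x hx))
      rw [abs_div, abs_of_pos hx0, abs_mul, abs_of_pos (by positivity : (0 : ℝ) < 2 * (ν + 1))]
      refine (div_le_self (by positivity) h1).trans ?_
      gcongr
      exact hD x hx

/-! ### The Abel moments of `J_ν` -/

lemma integrableOn_pow_mul_exp_neg_mul (k : ℕ) {s : ℝ} (hs : 0 < s) :
    IntegrableOn (fun x : ℝ => x ^ k * Real.exp (-s * x)) (Ioi 0) := by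
  refine (integrableOn_rpow_mul_exp_neg_mul_rpow (s := k) (p := 1) (b := s)
    (by linarith [k.cast_nonneg (α := ℝ)]) one_pos hs).congr_fun (fun x _ => ?_) measurableSet_Ioi
  simp [Real.rpow_natCast]

lemma integral_pow_mul_exp_neg_mul (k : ℕ) {s : ℝ} (hs : 0 < s) :
    ∫ x in Ioi (0 : ℝ), x ^ k * Real.exp (-s * x) = k.factorial / s ^ (k + 1) := by
  have h := Real.integral_rpow_mul_exp_neg_mul_Ioi (a := (k : ℝ) + 1) (by positivity) hs
  rw [Real.Gamma_nat_eq_factorial, add_sub_cancel_right] at h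
  simp only [Real.rpow_natCast] at h
  rw [show ((k : ℝ) + 1) = ((k + 1 : ℕ) : ℝ) by push_cast; rfl, Real.rpow_natCast] at h
  simp only [neg_mul]
  rw [h, one_div, inv_pow]
  ring

/-- The regularised moments `∫_0^∞ x^k J_ν(x) e^{-s x} dx` of the Bessel function. -/
noncomputable def besselLaplace (k ν : ℕ) (s : ℝ) : ℝ :=
  ∫ x in Ioi (0 : ℝ), x ^ k * besselJ ν x * Real.exp (-s * x)

lemma integrableOn_besselLaplace (k ν : ℕ) {s : ℝ} (hs : 0 < s) :
    IntegrableOn (fun x : ℝ => x ^ k * besselJ ν x * Real.exp (-s * x)) (Ioi 0) := by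
  obtain ⟨C, hC⟩ := exists_abs_besselJ_le ν
  have hc := continuous_besselJ ν
  refine ((integrableOn_pow_mul_exp_neg_mul k hs).const_mul C).mono'
    (by fun_prop) ?_
  filter_upwards [ae_restrict_mem measurableSet_Ioi] with x hx
  have hx0 : (0 : ℝ) < x := hx
  rw [norm_mul, norm_mul, Real.norm_eq_abs, Real.norm_eq_abs, Real.norm_eq_abs,
    abs_of_pos (pow_pos hx0 k), Real.abs_exp, mul_right_comm, mul_comm]
  gcongr
  exact hC x hx0.le

lemma exists_abs_besselLaplace_le (k ν : ℕ) :
    ∃ C, ∀ s, 0 < s → |besselLaplace k ν s| ≤ C / s ^ (k + 1) := by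
  obtain ⟨C, hC⟩ := exists_abs_besselJ_le ν
  refine ⟨C * k.factorial, fun s hs => ?_⟩
  rw [mul_div_assoc, ← integral_pow_mul_exp_neg_mul k hs, ← integral_const_mul, ← Real.norm_eq_abs]
  refine norm_integral_le_of_norm_le ((integrableOn_pow_mul_exp_neg_mul k hs).const_mul C) ?_
  filter_upwards [ae_restrict_mem measurableSet_Ioi] with x hx
  have hx0 : (0 : ℝ) < x := hx
  rw [norm_mul, norm_mul, Real.norm_eq_abs, Real.norm_eq_abs, Real.norm_eq_abs,
    abs_of_pos (pow_pos hx0 k), Real.abs_exp, mul_right_comm, mul_comm]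
  gcongr
  exact hC x hx0.le

lemma tendsto_pow_mul_besselJ_mul_exp (k ν : ℕ) {s : ℝ} (hs : 0 < s) :
    Tendsto (fun x : ℝ => x ^ k * besselJ ν x * Real.exp (-s * x)) atTop (𝓝 0) := by
  obtain ⟨C, hC⟩ := exists_abs_besselJ_le ν
  have h := (tendsto_rpow_mul_exp_neg_mul_atTop_nhds_zero k s hs).const_mul C
  rw [mul_zero] at h
  refine squeeze_zero_norm' ?_ h
  filter_upwards [eventually_gt_atTop 0] with x hx0
  rw [norm_mul, norm_mul, Real.norm_eq_abs, Real.norm_eq_abs, Real.norm_eq_abs,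
    abs_of_pos (pow_pos hx0 k), Real.abs_exp, mul_right_comm, mul_comm, Real.rpow_natCast]
  gcongr
  exact hC x hx0.le

lemma hasDerivAt_exp_neg_mul (s x : ℝ) :
    HasDerivAt (fun x : ℝ => Real.exp (-s * x)) (Real.exp (-s * x) * -s) x := by
  simpa using ((hasDerivAt_id x).const_mul (-s)).exp

/-- Integration by parts: the integral of the derivative of `x^{k+1} J_ν(x) e^{-sx}` is `0`. -/
lemma besselLaplace_succ_succ (k ν : ℕ) {s : ℝ} (hs : 0 < s) :
    besselLaplace (k + 1) (ν + 1) s =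
      (ν + k + 1) * besselLaplace k ν s - s * besselLaplace (k + 1) ν s := by
  have h1 := (integrableOn_besselLaplace k ν hs).const_mul ((ν : ℝ) + k + 1)
  have h2 := (integrableOn_besselLaplace (k + 1) ν hs).const_mul s
  have h3 := integrableOn_besselLaplace (k + 1) (ν + 1) hs
  have key := integral_Ioi_of_hasDerivAt_of_tendsto'
    (f := fun x => x ^ (k + 1) * besselJ ν x * Real.exp (-s * x)) (a := 0) (fun x _ => by
      refine (((hasDerivAt_pow (k + 1) x).mul (differentiable_besselJ ν x).hasDerivAt).mul
        (hasDerivAt_exp_neg_mul s x)).congr_deriv (g' :=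
          (ν + k + 1) * (x ^ k * besselJ ν x * Real.exp (-s * x)) -
          s * (x ^ (k + 1) * besselJ ν x * Real.exp (-s * x)) -
          x ^ (k + 1) * besselJ (ν + 1) x * Real.exp (-s * x)) ?_
      have := mul_deriv_besselJ ν x
      simp only [Pi.mul_apply, Nat.add_sub_cancel]
      push_cast
      linear_combination x ^ k * Real.exp (-s * x) * this)
    ((h1.sub h2).sub h3) (tendsto_pow_mul_besselJ_mul_exp (k + 1) ν hs)
  rw [integral_sub' (h1.sub h2) h3, integral_sub' h1 h2, integral_const_mul, integral_const_mul] at key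
  simp only [besselLaplace]
  simp only [ne_eq, Nat.add_eq_zero_iff, one_ne_zero, and_false, not_false_eq_true, zero_pow,
    zero_mul, sub_self] at key
  linarith

lemma besselLaplace_recurrence (k ν : ℕ) {s : ℝ} (hs : 0 < s) :
    besselLaplace (k + 1) ν s + besselLaplace (k + 1) (ν + 2) s =
      2 * (ν + 1) * besselLaplace k (ν + 1) s := by
  simp only [besselLaplace]
  rw [← integral_add (integrableOn_besselLaplace _ _ hs) (integrableOn_besselLaplace _ _ hs),
    ← integral_const_mul]
  congr 1
  ext x
  linear_combination x ^ k * Real.exp (-s * x) * mul_besselJ_add_besselJ ν x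

/-- The recurrence that raises the power of `x`; its coefficient `1 + s²` stays away from `0` as
`s → 0`. -/
lemma one_add_sq_mul_besselLaplace_succ (k ν : ℕ) {s : ℝ} (hs : 0 < s) :
    (1 + s ^ 2) * besselLaplace (k + 1) ν s =
      (ν - k) * besselLaplace k (ν + 1) s + s * (ν + k + 1) * besselLaplace k ν s := by
  have h1 := besselLaplace_succ_succ k ν hs
  have h2 := besselLaplace_succ_succ k (ν + 1) hs
  have h3 := besselLaplace_recurrence k ν hs
  push_cast at h2
  linear_combination h3 - h2 + s * h1

lemma besselLaplace_zero_one {s : ℝ} (hs : 0 < s) :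
    besselLaplace 0 1 s = 1 - s * besselLaplace 0 0 s := by
  have h1 := integrableOn_besselLaplace 0 1 hs
  have h2 := (integrableOn_besselLaplace 0 0 hs).const_mul s
  have key := integral_Ioi_of_hasDerivAt_of_tendsto'
    (f := fun x => x ^ 0 * besselJ 0 x * Real.exp (-s * x)) (a := 0) (fun x _ => by
      refine (((hasDerivAt_pow 0 x).mul (hasDerivAt_besselJ_zero x)).mul
        (hasDerivAt_exp_neg_mul s x)).congr_deriv (g' :=
        -(x ^ 0 * besselJ 1 x * Real.exp (-s * x)) -
          s * (x ^ 0 * besselJ 0 x * Real.exp (-s * x))) ?_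
      simp only [Pi.mul_apply]
      push_cast
      ring)
    (h1.neg.sub h2) (tendsto_pow_mul_besselJ_mul_exp 0 0 hs)
  rw [integral_sub' h1.neg h2, integral_neg', integral_const_mul] at key
  simp only [besselJ_zero_zero, mul_zero, Real.exp_zero] at key
  simp only [besselLaplace]
  linarith

lemma besselLaplace_zero_succ_succ (ν : ℕ) {s : ℝ} (hs : 0 < s) :
    besselLaplace 0 (ν + 2) s = besselLaplace 0 ν s - 2 * s * besselLaplace 0 (ν + 1) s := by
  have h1 := (integrableOn_besselLaplace 0 ν hs).const_mul (1 / 2)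
  have h2 := (integrableOn_besselLaplace 0 (ν + 2) hs).const_mul (1 / 2)
  have h3 := (integrableOn_besselLaplace 0 (ν + 1) hs).const_mul s
  have key := integral_Ioi_of_hasDerivAt_of_tendsto'
    (f := fun x => x ^ 0 * besselJ (ν + 1) x * Real.exp (-s * x)) (a := 0) (fun x _ => by
      refine (((hasDerivAt_pow 0 x).mul (hasDerivAt_besselJ_succ ν x)).mul
        (hasDerivAt_exp_neg_mul s x)).congr_deriv (g' :=
        1 / 2 * (x ^ 0 * besselJ ν x * Real.exp (-s * x)) -
          1 / 2 * (x ^ 0 * besselJ (ν + 2) x * Real.exp (-s * x)) -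
          s * (x ^ 0 * besselJ (ν + 1) x * Real.exp (-s * x))) ?_
      simp only [Pi.mul_apply]
      push_cast
      ring)
    ((h1.sub h2).sub h3) (tendsto_pow_mul_besselJ_mul_exp 0 (ν + 1) hs)
  rw [integral_sub' (h1.sub h2) h3, integral_sub' h1 h2, integral_const_mul, integral_const_mul,
    integral_const_mul] at key
  simp only [besselJ_succ_zero, mul_zero, zero_mul, sub_zero] at key
  simp only [besselLaplace]
  linarith

/-- Differentiation under the integral sign, dominated for `t > s/2` by a multiple of
`x e^{-sx/2}`. -/
lemma hasDerivAt_besselLaplace_zero_zero {s : ℝ} (hs : 0 < s) :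
    HasDerivAt (besselLaplace 0 0) (-besselLaplace 1 0 s) s := by
  obtain ⟨C, hC⟩ := exists_abs_besselJ_le 0
  have hc := continuous_besselJ 0
  have h := (hasDerivAt_integral_of_dominated_loc_of_deriv_le (μ := volume.restrict (Ioi (0 : ℝ)))
    (F := fun s x => x ^ 0 * besselJ 0 x * Real.exp (-s * x))
    (F' := fun s x => -(x ^ 1 * besselJ 0 x * Real.exp (-s * x)))
    (bound := fun x => C * (x ^ 1 * Real.exp (-(s / 2) * x)))
    (Ioi_mem_nhds (half_lt_self hs))
    (Eventually.of_forall fun t => by fun_prop) (integrableOn_besselLaplace 0 0 hs)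
    (by fun_prop) ?_ ((integrableOn_pow_mul_exp_neg_mul 1 (half_pos hs)).const_mul C) ?_).2
  · rwa [integral_neg] at h
  · filter_upwards [ae_restrict_mem measurableSet_Ioi] with x hx t ht
    have hx0 : (0 : ℝ) < x := hx
    rw [norm_neg, norm_mul, norm_mul, Real.norm_eq_abs, Real.norm_eq_abs, Real.norm_eq_abs,
      abs_of_pos (pow_pos hx0 1), Real.abs_exp, mul_right_comm, mul_comm]
    have := hC x hx0.le
    have ht' : s / 2 ≤ t := (mem_Ioi.1 ht).le
    gcongr
    exact (abs_nonneg _).trans this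
  · refine Eventually.of_forall fun x t _ => ?_
    have : HasDerivAt (fun t : ℝ => Real.exp (-t * x)) (Real.exp (-t * x) * -x) t := by
      simpa using ((hasDerivAt_id t).neg.mul_const x).exp
    refine (this.const_mul _).congr_deriv ?_
    ring

/-- `∫_0^∞ J_0(x) e^{-s x} dx = 1 / √(1 + s²)`: the product with `√(1 + s²)` has derivative `0` on
`(0, ∞)` and tends to `1` at infinity. -/
lemma sqrt_mul_besselLaplace_zero_zero {s : ℝ} (hs : 0 < s) :
    √(1 + s ^ 2) * besselLaplace 0 0 s = 1 := by
  have hd : ∀ t ∈ Ioi (0 : ℝ), HasDerivAt (fun t => √(1 + t ^ 2) * besselLaplace 0 0 t) 0 t := by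
    intro t ht
    have hpos : (0 : ℝ) < 1 + t ^ 2 := by positivity
    have h1 : HasDerivAt (fun t : ℝ => 1 + t ^ 2) (2 * t) t := by
      simpa using (hasDerivAt_pow 2 t).const_add 1
    refine ((h1.sqrt hpos.ne').mul (hasDerivAt_besselLaplace_zero_zero ht)).congr_deriv ?_
    have h2 := one_add_sq_mul_besselLaplace_succ 0 0 ht
    have hsq := Real.sq_sqrt hpos.le
    have hs0 := (Real.sqrt_pos.2 hpos).ne'
    simp only [CharP.cast_eq_zero, sub_self, zero_mul, zero_add, mul_one] at h2
    field_simp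
    rw [hsq]
    linear_combination -h2
  have hlim : Tendsto (fun t => √(1 + t ^ 2) * besselLaplace 0 0 t) atTop (𝓝 1) := by
    obtain ⟨C, hC⟩ := exists_abs_besselLaplace_le 0 1
    have h1 : Tendsto (fun t => besselLaplace 0 1 t) atTop (𝓝 0) := by
      refine squeeze_zero_norm' (a := fun t => C / t) ?_
        (tendsto_const_nhds.div_atTop tendsto_id)
      filter_upwards [eventually_gt_atTop 0] with t ht
      simpa using hC t ht
    have h2 : Tendsto (fun t : ℝ => √(t⁻¹ ^ 2 + 1)) atTop (𝓝 1) := by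
      have : Tendsto (fun t : ℝ => √(t⁻¹ ^ 2 + 1)) atTop (𝓝 √(0 ^ 2 + 1)) :=
        ((tendsto_inv_atTop_zero.pow 2).add_const 1).sqrt
      simpa using this
    have h3 := h2.mul (h1.const_sub 1)
    rw [sub_zero, mul_one] at h3
    refine h3.congr' ?_
    filter_upwards [eventually_gt_atTop 0] with t ht
    have : √(1 + t ^ 2) = t * √(t⁻¹ ^ 2 + 1) := by
      rw [← Real.sqrt_sq ht.le, ← Real.sqrt_mul (sq_nonneg t), Real.sqrt_sq ht.le]
      congr 1
      field_simp
    rw [besselLaplace_zero_one ht, this]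
    ring
  have hconst : ∀ t ∈ Ioi (0 : ℝ), √(1 + t ^ 2) * besselLaplace 0 0 t =
      √(1 + s ^ 2) * besselLaplace 0 0 s := fun t ht =>
    isOpen_Ioi.is_const_of_deriv_eq_zero isPreconnected_Ioi
      (fun t ht => (hd t ht).differentiableAt.differentiableWithinAt)
      (fun t ht => (hd t ht).deriv) ht hs
  refine tendsto_nhds_unique (tendsto_const_nhds.congr' ?_) hlim
  filter_upwards [eventually_gt_atTop 0] with t ht
  exact (hconst t ht).symm

lemma tendsto_besselLaplace_zero (ν : ℕ) :
    Tendsto (besselLaplace 0 ν) (𝓝[>] 0) (𝓝 1) := by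
  have hid : Tendsto (fun s : ℝ => s) (𝓝[>] 0) (𝓝 0) :=
    tendsto_nhdsWithin_of_tendsto_nhds tendsto_id
  have h0 : Tendsto (besselLaplace 0 0) (𝓝[>] 0) (𝓝 1) := by
    have h : Tendsto (fun s : ℝ => (√(1 + s ^ 2))⁻¹) (𝓝[>] 0) (𝓝 (√(1 + 0 ^ 2))⁻¹) :=
      (((hid.pow 2).const_add 1).sqrt).inv₀ (by simp)
    simp only [ne_eq, OfNat.ofNat_ne_zero, not_false_eq_true, zero_pow, add_zero, Real.sqrt_one,
      inv_one] at h
    refine h.congr' ?_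
    filter_upwards [self_mem_nhdsWithin] with s hs
    exact (eq_inv_of_mul_eq_one_right (sqrt_mul_besselLaplace_zero_zero hs)).symm
  suffices h : ∀ ν, Tendsto (besselLaplace 0 ν) (𝓝[>] 0) (𝓝 1) ∧
      Tendsto (besselLaplace 0 (ν + 1)) (𝓝[>] 0) (𝓝 1) from (h ν).1
  intro ν
  induction ν with
  | zero =>
    refine ⟨h0, ?_⟩
    have h := (hid.mul h0).const_sub 1
    rw [zero_mul, sub_zero] at h
    refine h.congr' ?_
    filter_upwards [self_mem_nhdsWithin] with s hs
    exact (besselLaplace_zero_one hs).symm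
  | succ ν ih =>
    refine ⟨ih.2, ?_⟩
    have h := ih.1.sub ((hid.const_mul 2).mul ih.2)
    rw [mul_zero, zero_mul, sub_zero] at h
    refine h.congr' ?_
    filter_upwards [self_mem_nhdsWithin] with s hs
    exact (besselLaplace_zero_succ_succ ν hs).symm

/-- The value `2^k Γ((ν + k + 1)/2) / Γ((ν - k + 1)/2)` of the Abel integral `∫_0^∞ x^k J_ν(x) dx`;
it is `0` when the denominator is at a pole, where `Real.Gamma` vanishes. -/
noncomputable def besselMoment (k ν : ℕ) : ℝ :=
  2 ^ k * (Real.Gamma (((ν : ℝ) + k + 1) / 2) / Real.Gamma (((ν : ℝ) - k + 1) / 2))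

/-- The functional equation of `1 / Γ`, valid also at the poles of `Γ` because there
`(Real.Gamma x)⁻¹ = 0`. -/
lemma inv_Gamma_eq (x : ℝ) : (Real.Gamma x)⁻¹ = x * (Real.Gamma (x + 1))⁻¹ := by
  rcases eq_or_ne x 0 with rfl | hx
  · simp [Real.Gamma_zero]
  · rw [Real.Gamma_add_one hx, mul_inv, ← mul_assoc, mul_inv_cancel₀ hx, one_mul]

lemma besselMoment_zero (ν : ℕ) : besselMoment 0 ν = 1 := by
  have : Real.Gamma (((ν : ℝ) + 1) / 2) ≠ 0 := (Real.Gamma_pos_of_pos (by positivity)).ne'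
  simp [besselMoment, this]

lemma besselMoment_succ (k ν : ℕ) :
    besselMoment (k + 1) ν = (ν - k) * besselMoment k (ν + 1) := by
  simp only [besselMoment]
  push_cast
  rw [div_eq_mul_inv, inv_Gamma_eq,
    show ((ν : ℝ) - (k + 1) + 1) / 2 + 1 = (ν + 1 - k + 1) / 2 by ring,
    show (ν : ℝ) + (k + 1) + 1 = ν + 1 + k + 1 by ring]
  ring

lemma tendsto_besselLaplace (k ν : ℕ) :
    Tendsto (besselLaplace k ν) (𝓝[>] 0) (𝓝 (besselMoment k ν)) := by
  have hid : Tendsto (fun s : ℝ => s) (𝓝[>] 0) (𝓝 0) :=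
    tendsto_nhdsWithin_of_tendsto_nhds tendsto_id
  induction k generalizing ν with
  | zero =>
    rw [besselMoment_zero]
    exact tendsto_besselLaplace_zero ν
  | succ k ih =>
    have h := (((ih (ν + 1)).const_mul ((ν : ℝ) - k)).add
      ((hid.mul_const ((ν : ℝ) + k + 1)).mul (ih ν))).div ((hid.pow 2).const_add 1) (by simp)
    rw [← besselMoment_succ] at h
    simp only [zero_mul, add_zero, ne_eq, OfNat.ofNat_ne_zero, not_false_eq_true, zero_pow,
      div_one] at h
    refine h.congr' ?_
    filter_upwards [self_mem_nhdsWithin] with s hs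
    rw [Pi.div_apply, ← one_add_sq_mul_besselLaplace_succ k ν hs]
    exact mul_div_cancel_left₀ _ (by positivity)

lemma besselMoment_eq_zero {k ν : ℕ} (hk : ν < k) (hodd : Odd (k - ν)) : besselMoment k ν = 0 := by
  obtain ⟨m, hm⟩ := hodd
  have : ((ν : ℝ) - k + 1) / 2 = -(m : ℝ) := by
    have : (k : ℝ) = ν + 2 * m + 1 := by exact_mod_cast (by omega : k = ν + 2 * m + 1)
    rw [this]
    ring
  rw [besselMoment, this, Real.Gamma_neg_nat_eq_zero, div_zero, mul_zero]

lemma besselMoment_succ_succ (k ν : ℕ) :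
    besselMoment (k + 1) (ν + 1) = (ν + k + 1) * besselMoment k ν := by
  simp only [besselMoment]
  push_cast
  rw [show ((ν : ℝ) + 1 + (k + 1) + 1) / 2 = (ν + k + 1) / 2 + 1 by ring,
    Real.Gamma_add_one (by positivity), show (ν : ℝ) + 1 - (k + 1) + 1 = ν - k + 1 by ring]
  ring

lemma besselMoment_add_two (k ν : ℕ) :
    besselMoment (k + 2) ν = ((ν : ℝ) ^ 2 - (k + 1) ^ 2) * besselMoment k ν := by
  rw [besselMoment_succ (k + 1), besselMoment_succ_succ]
  push_cast
  ring

/-! ### The moments of `K_ν` -/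

lemma cosh_div_cosh_pow_le {k ν : ℕ} (h : ν ≤ k) {u : ℝ} (hu : 0 ≤ u) :
    Real.cosh (ν * u) / Real.cosh u ^ (k + 1) ≤ 2 ^ (k + 1) * Real.exp (-1 * u) := by
  have h1 : Real.cosh (ν * u) ≤ Real.exp (k * u) := by
    rw [Real.cosh_eq]
    have h2 : Real.exp (ν * u) ≤ Real.exp (k * u) := by gcongr
    have h3 : Real.exp (-(ν * u)) ≤ Real.exp (k * u) := by
      refine Real.exp_le_exp.2 (le_trans ?_ (by positivity : 0 ≤ k * u))
      exact neg_nonpos.2 (by positivity)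
    linarith
  have h4 : Real.exp u / 2 ≤ Real.cosh u := by
    rw [Real.cosh_eq]
    have := Real.exp_pos (-u)
    linarith
  calc Real.cosh (ν * u) / Real.cosh u ^ (k + 1)
      ≤ Real.exp (k * u) / (Real.exp u / 2) ^ (k + 1) := by gcongr
    _ = 2 ^ (k + 1) * Real.exp (-1 * u) := by
      rw [div_pow, ← Real.exp_nat_mul, div_div_eq_mul_div, mul_div_right_comm, ← Real.exp_sub,
        mul_comm]
      congr 2
      push_cast
      ring

/-- The integrals `∫_0^∞ cosh(νu) / cosh(u)^{k+1} du`. -/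
noncomputable def coshIntegral (k ν : ℕ) : ℝ :=
  ∫ u in Ioi (0 : ℝ), Real.cosh (ν * u) / Real.cosh u ^ (k + 1)

lemma continuous_cosh_div_cosh_pow (k ν : ℕ) :
    Continuous fun u : ℝ => Real.cosh (ν * u) / Real.cosh u ^ (k + 1) :=
  Continuous.div (by fun_prop) (by fun_prop) fun u => (pow_pos (Real.cosh_pos u) _).ne'

lemma integrableOn_cosh_div_cosh_pow {k ν : ℕ} (h : ν ≤ k) :
    IntegrableOn (fun u : ℝ => Real.cosh (ν * u) / Real.cosh u ^ (k + 1)) (Ioi 0) := by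
  have hexp : IntegrableOn (fun u : ℝ => Real.exp (-1 * u)) (Ioi 0) := by
    simpa using integrableOn_pow_mul_exp_neg_mul 0 one_pos
  refine (hexp.const_mul (2 ^ (k + 1))).mono'
    (continuous_cosh_div_cosh_pow k ν).aestronglyMeasurable ?_
  filter_upwards [ae_restrict_mem measurableSet_Ioi] with u hu
  rw [Real.norm_of_nonneg (by have := Real.cosh_pos u; have := Real.cosh_pos (ν * u); positivity)]
  exact cosh_div_cosh_pow_le h (mem_Ioi.1 hu).le

lemma tendsto_sinh_div_cosh_pow {k ν : ℕ} (h : ν ≤ k) :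
    Tendsto (fun u : ℝ => Real.sinh (ν * u) / Real.cosh u ^ (k + 1)) atTop (𝓝 0) := by
  have hexp : Tendsto (fun u : ℝ => (2 : ℝ) ^ (k + 1) * Real.exp (-1 * u)) atTop (𝓝 0) := by
    simpa using Real.tendsto_exp_neg_atTop_nhds_zero.const_mul ((2 : ℝ) ^ (k + 1))
  refine squeeze_zero_norm' ?_ hexp
  filter_upwards [eventually_ge_atTop 0] with u hu
  refine le_trans ?_ (cosh_div_cosh_pow_le h hu)
  rw [norm_div, Real.norm_eq_abs, Real.norm_of_nonneg (pow_pos (Real.cosh_pos u) _).le]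
  have hc := Real.cosh_pos u
  gcongr
  rw [Real.abs_sinh, ← Real.cosh_abs]
  exact (Real.sinh_lt_cosh _).le

lemma hasDerivAt_sinh_div_cosh_pow (k ν : ℕ) (u : ℝ) :
    HasDerivAt (fun u : ℝ => Real.sinh (ν * u) / Real.cosh u ^ (k + 1))
      (ν * (Real.cosh (ν * u) / Real.cosh u ^ (k + 1)) -
        (k + 1) * (Real.sinh (ν * u) * Real.sinh u / Real.cosh u ^ (k + 2))) u := by
  have hc := (Real.cosh_pos u).ne'
  have h1 : HasDerivAt (fun u : ℝ => Real.sinh (ν * u)) (Real.cosh (ν * u) * ν) u := by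
    simpa using ((hasDerivAt_id u).const_mul (ν : ℝ)).sinh
  refine (h1.div ((Real.hasDerivAt_cosh u).pow (k + 1)) (pow_ne_zero _ hc)).congr_deriv ?_
  simp only [Pi.pow_apply, Nat.add_sub_cancel]
  push_cast
  field_simp
  ring

/-- From the derivative of `sinh(νu) / cosh(u)^{k+1}`, by the addition theorem for
`cosh((ν + 1)u)`. -/
lemma coshIntegral_succ_succ {k ν : ℕ} (h : ν ≤ k) :
    (k + 1) * coshIntegral (k + 1) (ν + 1) = (ν + k + 1) * coshIntegral k ν := by
  have h1 := (integrableOn_cosh_div_cosh_pow h).const_mul ((ν : ℝ) + k + 1)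
  have h2 := (integrableOn_cosh_div_cosh_pow (Nat.succ_le_succ h)).const_mul ((k : ℝ) + 1)
  have key := integral_Ioi_of_hasDerivAt_of_tendsto' (a := 0) (fun u _ => by
    refine (hasDerivAt_sinh_div_cosh_pow k ν u).congr_deriv (g' :=
      ((ν : ℝ) + k + 1) * (Real.cosh (ν * u) / Real.cosh u ^ (k + 1)) -
        ((k : ℝ) + 1) * (Real.cosh ((ν + 1 : ℕ) * u) / Real.cosh u ^ (k + 1 + 1))) ?_
    have hc := (Real.cosh_pos u).ne'
    push_cast
    rw [add_mul (ν : ℝ) 1 u, one_mul, Real.cosh_add]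
    field_simp
    ring) (h1.sub h2) (tendsto_sinh_div_cosh_pow h)
  rw [integral_sub' h1 h2, integral_const_mul, integral_const_mul] at key
  simp only [mul_zero, Real.sinh_zero, zero_div, sub_zero, sub_eq_zero] at key
  exact key.symm

/-- From the derivative of `sinh(u) / cosh(u)^{k+2}`. -/
lemma coshIntegral_add_two (k : ℕ) :
    (k + 2) * coshIntegral (k + 2) 0 = (k + 1) * coshIntegral k 0 := by
  have h1 := (integrableOn_cosh_div_cosh_pow (Nat.zero_le (k + 2))).const_mul ((k : ℝ) + 2)
  have h2 := (integrableOn_cosh_div_cosh_pow (Nat.zero_le k)).const_mul ((k : ℝ) + 1)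
  have key := integral_Ioi_of_hasDerivAt_of_tendsto' (a := 0) (fun u _ => by
    refine (hasDerivAt_sinh_div_cosh_pow (k + 1) 1 u).congr_deriv (g' :=
      ((k : ℝ) + 2) * (Real.cosh ((0 : ℕ) * u) / Real.cosh u ^ (k + 2 + 1)) -
        ((k : ℝ) + 1) * (Real.cosh ((0 : ℕ) * u) / Real.cosh u ^ (k + 1))) ?_
    have hc := (Real.cosh_pos u).ne'
    have hsq := Real.cosh_sq u
    push_cast
    rw [one_mul, zero_mul, Real.cosh_zero]
    field_simp
    linear_combination (k + 2) * Real.cosh u ^ (2 * k + 3) * hsq) (h1.sub h2)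
    (tendsto_sinh_div_cosh_pow (Nat.le_add_left 1 k))
  rw [integral_sub' h1 h2, integral_const_mul, integral_const_mul] at key
  simp only [mul_zero, Real.sinh_zero, zero_div, sub_zero, sub_eq_zero] at key
  exact key

lemma coshIntegral_zero_zero : coshIntegral 0 0 = Real.pi / 2 := by
  have hlim : Tendsto (fun u => Real.arctan (Real.sinh u)) atTop (𝓝 (Real.pi / 2)) := by
    refine (tendsto_nhds_of_tendsto_nhdsWithin Real.tendsto_arctan_atTop).comp ?_
    refine tendsto_atTop_mono' atTop ?_ tendsto_id
    filter_upwards [eventually_ge_atTop 0] with u hu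
    exact Real.self_le_sinh_iff.2 hu
  have key := integral_Ioi_of_hasDerivAt_of_tendsto' (a := 0) (fun u _ => by
    refine (Real.hasDerivAt_sinh u).arctan.congr_deriv (g' :=
      Real.cosh ((0 : ℕ) * u) / Real.cosh u ^ (0 + 1)) ?_
    have hc := (Real.cosh_pos u).ne'
    rw [← Real.cosh_sq']
    simp
    field_simp) (integrableOn_cosh_div_cosh_pow le_rfl) hlim
  simpa [coshIntegral] using key

/-- The integral defining `K_ν(x)` converges, as `e^{-y} ≤ (ν + 1)! / y^{ν + 1}` at
`y = x cosh t`. -/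
lemma besselK_integrableOn (ν : ℕ) {x : ℝ} (hx : 0 < x) :
    IntegrableOn (fun t : ℝ => Real.exp (-x * Real.cosh t) * Real.cosh (ν * t)) (Ioi 0) := by
  refine ((integrableOn_cosh_div_cosh_pow (le_refl ν)).const_mul
    ((ν + 1).factorial / x ^ (ν + 1))).mono' (by fun_prop) (Eventually.of_forall fun t => ?_)
  have hc := Real.cosh_pos t
  have hc' := Real.cosh_pos (ν * t)
  rw [Real.norm_of_nonneg (by positivity)]
  have h := Real.pow_div_factorial_le_exp (x * Real.cosh t) (by positivity) (ν + 1)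
  have h2 : Real.exp (-x * Real.cosh t) ≤ (ν + 1).factorial / (x * Real.cosh t) ^ (ν + 1) := by
    rw [neg_mul, Real.exp_neg, ← inv_div]
    exact inv_anti₀ (by positivity) h
  calc _ ≤ (ν + 1).factorial / (x * Real.cosh t) ^ (ν + 1) * Real.cosh (ν * t) := by gcongr
    _ = _ := by
      rw [mul_pow]
      field_simp

lemma besselK_pos (ν : ℕ) {x : ℝ} (hx : 0 < x) : 0 < besselK ν x := by
  have hpos : ∀ t : ℝ, 0 < Real.exp (-x * Real.cosh t) * Real.cosh (ν * t) := fun t =>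
    mul_pos (Real.exp_pos _) (Real.cosh_pos _)
  rw [besselK, setIntegral_pos_iff_support_of_nonneg_ae
    (Eventually.of_forall fun t => (hpos t).le) (besselK_integrableOn ν hx)]
  have : Function.support (fun t : ℝ => Real.exp (-x * Real.cosh t) * Real.cosh (ν * t)) = univ :=
    eq_univ_of_forall fun t => (hpos t).ne'
  rw [this, univ_inter]
  simp

lemma integral_pow_mul_exp_mul_cosh (k ν : ℕ) (u : ℝ) :
    ∫ t in Ioi (0 : ℝ), t ^ k * (Real.exp (-t * Real.cosh u) * Real.cosh (ν * u)) =
      k.factorial * (Real.cosh (ν * u) / Real.cosh u ^ (k + 1)) := by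
  rw [mul_div_left_comm, ← integral_pow_mul_exp_neg_mul k (Real.cosh_pos u), ← integral_const_mul]
  congr 1
  ext t
  rw [show -t * Real.cosh u = -Real.cosh u * t by ring]
  ring

lemma integrable_prod_pow_mul_exp_mul_cosh {k ν : ℕ} (h : ν ≤ k) :
    Integrable (fun z : ℝ × ℝ =>
        z.1 ^ k * (Real.exp (-z.1 * Real.cosh z.2) * Real.cosh (ν * z.2)))
      ((volume.restrict (Ioi 0)).prod (volume.restrict (Ioi 0))) := by
  rw [integrable_prod_iff' (by fun_prop)]
  constructor
  · refine Eventually.of_forall fun u => ?_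
    refine ((integrableOn_pow_mul_exp_neg_mul k (Real.cosh_pos u)).const_mul
      (Real.cosh (ν * u))).congr (Eventually.of_forall fun t => ?_)
    simp only [neg_mul, mul_comm t]
    ring
  · refine ((integrableOn_cosh_div_cosh_pow h).const_mul (k.factorial : ℝ)).congr
      (Eventually.of_forall fun u => ?_)
    simp only
    rw [← integral_pow_mul_exp_mul_cosh]
    refine setIntegral_congr_fun measurableSet_Ioi fun t ht => ?_
    have ht0 : (0 : ℝ) < t := ht
    have := Real.cosh_pos (ν * u)
    exact (Real.norm_of_nonneg (by positivity)).symm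

lemma integrableOn_pow_mul_besselK {k ν : ℕ} (h : ν ≤ k) :
    IntegrableOn (fun t : ℝ => t ^ k * besselK ν t) (Ioi 0) := by
  have := (integrable_prod_pow_mul_exp_mul_cosh h).integral_prod_left
  simp only [integral_const_mul] at this
  exact this

lemma integral_pow_mul_besselK {k ν : ℕ} (h : ν ≤ k) :
    ∫ t in Ioi (0 : ℝ), t ^ k * besselK ν t = k.factorial * coshIntegral k ν := by
  have := integral_integral_swap
    (f := fun t u : ℝ => t ^ k * (Real.exp (-t * Real.cosh u) * Real.cosh (ν * u)))
    (integrable_prod_pow_mul_exp_mul_cosh h)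
  simp only [integral_const_mul, integral_pow_mul_exp_mul_cosh] at this
  exact this

/-- The moments of `K_ν` that enter the Gauss rule determine those of `J_ν`. Both sides satisfy
the same recurrences in `(k, ν)`, which reduce the claim to `k = ν = 0`, where it reads
`∫_0^∞ du / cosh u = π / 2`. -/
lemma integral_pow_mul_besselK_eq_besselMoment {k ν : ℕ} (h : ν ≤ k) (heven : Even (k - ν)) :
    2 / Real.pi * Real.cos (((k : ℝ) - ν) * Real.pi / 2) *
      ∫ t in Ioi (0 : ℝ), t ^ k * besselK ν t = besselMoment k ν := by
  rw [integral_pow_mul_besselK h]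
  induction ν generalizing k with
  | zero =>
    obtain ⟨j, hj⟩ := heven
    obtain rfl : k = 2 * j := by omega
    clear h hj
    induction j with
    | zero =>
      rw [mul_zero, coshIntegral_zero_zero, besselMoment_zero]
      simp
    | succ j ih =>
      rw [show 2 * (j + 1) = 2 * j + 2 by ring, besselMoment_add_two, ← ih,
        Nat.factorial_succ, Nat.factorial_succ,
        show (((2 * j + 2 : ℕ) : ℝ) - (0 : ℕ)) * Real.pi / 2 =
          (((2 * j : ℕ) : ℝ) - (0 : ℕ)) * Real.pi / 2 + Real.pi by push_cast; ring,
        Real.cos_add_pi]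
      have h2 := coshIntegral_add_two (2 * j)
      push_cast at h2 ⊢
      linear_combination -(2 / Real.pi * Real.cos ((2 * j - 0) * Real.pi / 2) *
        ((2 * j + 1) * (2 * j).factorial)) * h2
  | succ ν ih =>
    obtain ⟨k, rfl⟩ : ∃ l, k = l + 1 := ⟨k - 1, by omega⟩
    rw [Nat.add_sub_add_right] at heven
    rw [besselMoment_succ_succ, ← ih (by omega) heven, Nat.factorial_succ,
      show (((k + 1 : ℕ) : ℝ) - (ν + 1 : ℕ)) = (k : ℝ) - ν by push_cast; ring]
    have h2 := coshIntegral_succ_succ (k := k) (ν := ν) (by omega)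
    push_cast
    linear_combination (2 / Real.pi * Real.cos ((k - ν) * Real.pi / 2) * k.factorial) * h2

/-! ### The generalized Prudnikov weight -/

/-- The number `κ` as a natural number: the least integer `≥ μ` of the parity of `ν`. -/
def kappaNat (μ ν : ℕ) : ℕ := if Even (μ - ν) then μ else μ + 1

lemma kappa_eq (μ ν : ℕ) : kappa μ ν = kappaNat μ ν := by
  rw [kappa, kappaNat]
  split_ifs <;> simp

lemma le_kappaNat (μ ν : ℕ) : μ ≤ kappaNat μ ν := by
  rw [kappaNat]
  split_ifs <;> omega

lemma even_kappaNat_sub {μ ν : ℕ} (h : ν ≤ μ) : Even (kappaNat μ ν - ν) := by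
  rw [kappaNat]
  split_ifs with he
  · exact he
  · rw [Nat.sub_add_comm h]
    exact (Nat.not_even_iff_odd.1 he).add_one

lemma kappaNat_le {μ ν k : ℕ} (hk : μ ≤ k) (he : Even (k - ν)) : kappaNat μ ν ≤ k := by
  rw [kappaNat]
  split_ifs with hμ
  · exact hk
  · rcases hk.eq_or_lt with rfl | hk
    · exact absurd he hμ
    · exact hk

lemma weight_eq (μ ν : ℕ) (x : ℝ) :
    weight μ ν x = besselK ν (√x) / 2 * x ^ (((kappaNat μ ν : ℝ) - 1) / 2) := by
  rw [weight, kappaNat]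
  split_ifs <;> simp

lemma weight_pos (μ ν : ℕ) {x : ℝ} (hx : 0 < x) : 0 < weight μ ν x := by
  have := besselK_pos ν (Real.sqrt_pos.2 hx)
  rw [weight_eq]
  positivity

lemma weight_sq_mul (μ ν m : ℕ) {t : ℝ} (ht : 0 < t) :
    (2 * t ^ ((2 : ℝ) - 1)) • (weight μ ν (t ^ (2 : ℝ)) * (t ^ (2 : ℝ)) ^ m) =
      t ^ (kappaNat μ ν + 2 * m) * besselK ν t := by
  have h1 : ((t ^ 2) ^ (((kappaNat μ ν : ℝ) - 1) / 2) : ℝ) * t = t ^ kappaNat μ ν := by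
    rw [← Real.rpow_natCast t 2, ← Real.rpow_mul ht.le, ← Real.rpow_add_one ht.ne',
      ← Real.rpow_natCast]
    congr 1
    push_cast
    ring
  rw [weight_eq, Real.rpow_two, Real.sqrt_sq ht.le, smul_eq_mul, pow_add, ← h1,
    show (2 : ℝ) - 1 = 1 by norm_num, Real.rpow_one]
  ring

lemma integrableOn_weight_mul_pow {μ ν : ℕ} (h : ν ≤ μ) (m : ℕ) :
    IntegrableOn (fun x => weight μ ν x * x ^ m) (Ioi 0) := by
  rw [← integrableOn_Ioi_comp_rpow_iff _ two_ne_zero]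
  refine (integrableOn_pow_mul_besselK (k := kappaNat μ ν + 2 * m) (ν := ν)
    (by have := le_kappaNat μ ν; omega)).congr_fun (fun t ht => ?_) measurableSet_Ioi
  simp only [abs_two]
  exact (weight_sq_mul μ ν m ht).symm

lemma integral_weight_mul_pow (μ ν m : ℕ) :
    ∫ x in Ioi (0 : ℝ), weight μ ν x * x ^ m =
      ∫ t in Ioi (0 : ℝ), t ^ (kappaNat μ ν + 2 * m) * besselK ν t := by
  rw [← integral_comp_rpow_Ioi_of_pos two_pos]
  exact setIntegral_congr_fun measurableSet_Ioi fun t ht => weight_sq_mul μ ν m ht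

lemma integrableOn_weight_mul_eval {μ ν : ℕ} (h : ν ≤ μ) (p : ℝ[X]) :
    IntegrableOn (fun x => weight μ ν x * p.eval x) (Ioi 0) := by
  induction p using Polynomial.induction_on' with
  | add p q hp hq =>
    simp only [Polynomial.eval_add, mul_add]
    exact hp.add hq
  | monomial m a =>
    simp only [Polynomial.eval_monomial, mul_left_comm _ a]
    exact (integrableOn_weight_mul_pow h m).const_mul a

lemma gauss_rule_weight {μ ν n : ℕ} (h : ν ≤ μ) (hn : 1 ≤ n) {p : ℝ[X]}
    (hp : p.natDegree ≤ 2 * n - 1) :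
    ∫ x in Ioi (0 : ℝ), weight μ ν x * p.eval x =
      ∑ x ∈ gaussNodes (weight μ ν) n, gaussWeight (weight μ ν) n x * p.eval x :=
  momentFunctional_eq_sum_gaussWeight (integrableOn_weight_mul_eval h)
    (fun _ => weight_pos μ ν) hn hp

lemma pos_of_mem_gaussNodes_weight {μ ν n : ℕ} (h : ν ≤ μ) {x : ℝ}
    (hx : x ∈ gaussNodes (weight μ ν) n) : 0 < x :=
  pos_of_mem_gaussNodes (integrableOn_weight_mul_eval h) (fun _ => weight_pos μ ν) hx

/-- The sum over the nodes that the rule contributes at a monomial of degree `k` agrees with the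
moment of `J_ν` for `μ ≤ k`. If `k - ν` is odd both sides vanish, the left one by the cosine and
the right one by a pole of `Γ`; if it is even, the Gauss rule is applied to `x^{(k - κ)/2}`. -/
lemma cos_mul_sum_gaussWeight {μ ν n k : ℕ} (h : ν ≤ μ) (hn : 1 ≤ n) (hk : μ ≤ k)
    (hkn : k < 4 * n + kappaNat μ ν) :
    2 / Real.pi * Real.cos (((k : ℝ) - ν) * Real.pi / 2) *
      ∑ x ∈ gaussNodes (weight μ ν) n,
        gaussWeight (weight μ ν) n x * x ^ (((k : ℝ) - kappa μ ν) / 2) = besselMoment k ν := by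
  by_cases he : Even (k - ν)
  · have hκ := kappaNat_le hk he
    obtain ⟨m, hm⟩ : ∃ m, k = kappaNat μ ν + 2 * m := by
      have hκe := even_kappaNat_sub h
      have := le_kappaNat μ ν
      rw [Nat.even_iff] at he hκe
      exact ⟨(k - kappaNat μ ν) / 2, by omega⟩
    have hsum := gauss_rule_weight h hn (p := Polynomial.X ^ m)
      (by rw [Polynomial.natDegree_X_pow]; omega)
    simp only [Polynomial.eval_pow, Polynomial.eval_X] at hsum
    rw [integral_weight_mul_pow, ← hm] at hsum
    rw [← integral_pow_mul_besselK_eq_besselMoment (h.trans hk) he, hsum]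
    congr 1
    refine Finset.sum_congr rfl fun x _ => ?_
    rw [← Real.rpow_natCast, kappa_eq, hm]
    congr 2
    push_cast
    ring
  · have hlt : ν < k := by
      rcases (h.trans hk).eq_or_lt with rfl | hlt
      · simp at he
      · exact hlt
    have hodd := Nat.not_even_iff_odd.1 he
    rw [besselMoment_eq_zero hlt hodd]
    obtain ⟨m, hm⟩ := hodd
    have hcos : Real.cos (((k : ℝ) - ν) * Real.pi / 2) = 0 := by
      rw [Real.cos_eq_zero_iff]
      refine ⟨m, ?_⟩
      have : (k : ℝ) = ν + 2 * m + 1 := by exact_mod_cast (by omega : k = ν + 2 * m + 1)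
      rw [this]
      push_cast
      ring
    rw [hcos, mul_zero, zero_mul]

/-! ### The Hankel transform of a polynomial -/

lemma ite_boundaryWeight_add {μ ν n k : ℕ} (h : ν ≤ μ) (hn : 1 ≤ n)
    (hkn : k < 4 * n + kappaNat μ ν) :
    (if k < μ then (k.factorial : ℝ) * boundaryWeight μ ν n k else 0) +
      2 / Real.pi * Real.cos (((k : ℝ) - ν) * Real.pi / 2) *
        ∑ x ∈ gaussNodes (weight μ ν) n,
          gaussWeight (weight μ ν) n x * x ^ (((k : ℝ) - kappa μ ν) / 2) = besselMoment k ν := by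
  split_ifs with hk
  · rw [boundaryWeight, besselMoment, ← mul_assoc, mul_one_div_cancel (by positivity), one_mul,
      sub_add_cancel]
  · rw [zero_add, cos_mul_sum_gaussWeight h hn (not_lt.1 hk) hkn]

/-- The two conjugate nodes `± i √x / ω` combine at a monomial:
`e^{-νπi/2} i^k + e^{νπi/2} (-i)^k = 2 cos((k - ν)π/2)`. -/
lemma interiorWeight_mul_pow_add (μ ν n k : ℕ) {x ω : ℝ} (hx : 0 < x) :
    interiorWeight μ ν n 1 x * (Complex.I * (√x : ℂ) / (ω : ℂ)) ^ k +
      interiorWeight μ ν n (-1) x * (-(Complex.I * (√x : ℂ)) / (ω : ℂ)) ^ k =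
    ((2 / Real.pi * Real.cos (((k : ℝ) - ν) * Real.pi / 2) *
      (gaussWeight (weight μ ν) n x * x ^ (((k : ℝ) - kappa μ ν) / 2)) : ℝ) : ℂ) /
        (ω : ℂ) ^ k := by
  have hpow : x ^ (((k : ℝ) - kappa μ ν) / 2) = x ^ (-(kappa μ ν) / 2) * √x ^ k := by
    rw [Real.sqrt_eq_rpow, ← Real.rpow_natCast, ← Real.rpow_mul hx.le, ← Real.rpow_add hx]
    congr 1
    ring
  have h1 : Complex.exp (-((1 : ℝ) : ℂ) * ν * Real.pi * Complex.I / 2) * Complex.I ^ k =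
      Complex.exp (((k : ℂ) - ν) * Real.pi / 2 * Complex.I) := by
    have hI : Complex.I ^ k = Complex.exp (k * (Real.pi / 2 * Complex.I)) := by
      rw [Complex.exp_nat_mul, Complex.exp_pi_div_two_mul_I]
    rw [hI, ← Complex.exp_add]
    congr 1
    push_cast
    ring
  have h2 : Complex.exp (-((-1 : ℝ) : ℂ) * ν * Real.pi * Complex.I / 2) * (-Complex.I) ^ k =
      Complex.exp (-(((k : ℂ) - ν) * Real.pi / 2) * Complex.I) := by
    have hI : (-Complex.I) ^ k = Complex.exp (k * (-Real.pi / 2 * Complex.I)) := by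
      rw [Complex.exp_nat_mul, Complex.exp_neg_pi_div_two_mul_I]
    rw [hI, ← Complex.exp_add]
    congr 1
    push_cast
    ring
  have h3 := Complex.two_cos (((k : ℂ) - ν) * Real.pi / 2)
  rw [← h1, ← h2] at h3
  rw [interiorWeight, interiorWeight, hpow, ← neg_mul]
  simp only [div_pow, mul_pow]
  push_cast at h3 ⊢
  linear_combination -(gaussWeight (weight μ ν) n x : ℂ) * (x ^ (-(kappa μ ν) / 2) : ℝ) *
    (√x : ℂ) ^ k / Real.pi / (ω : ℂ) ^ k * h3

lemma iteratedDeriv_eval_zero (p : ℂ[X]) (k : ℕ) :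
    iteratedDeriv k (fun z => p.eval z) 0 = k.factorial * p.coeff k := by
  have h : ∀ k, iteratedDeriv k (fun z => p.eval z) =
      fun z => (Polynomial.derivative^[k] p).eval z := fun k => by
    induction k with
    | zero => simp
    | succ k ih =>
      ext z
      rw [iteratedDeriv_succ, ih, Polynomial.deriv, Function.iterate_succ_apply']
  rw [h]
  simp only
  rw [← Polynomial.coeff_zero_eq_eval_zero, Polynomial.coeff_iterate_derivative, zero_add,
    Nat.descFactorial_self, nsmul_eq_mul]

lemma rule_eq_sum {μ ν n : ℕ} (h : ν ≤ μ) (hn : 1 ≤ n) {f : ℂ → ℂ} {p : ℂ[X]}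
    (hp : p.natDegree < 4 * n + kappaNat μ ν) (hf : EqOn f (fun z => p.eval z) {z : ℂ | 0 ≤ z.re})
    (hf0 : f =ᶠ[𝓝 0] fun z => p.eval z) (ω : ℝ) :
    rule μ ν n f ω = ∑ k ∈ Finset.range (4 * n + kappaNat μ ν),
      p.coeff k * ((besselMoment k ν / ω ^ (k + 1) : ℝ) : ℂ) := by
  have hsub : Finset.range μ ⊆ Finset.range (4 * n + kappaNat μ ν) :=
    Finset.range_subset_range.2 ((le_kappaNat μ ν).trans (Nat.le_add_left _ _))
  have hb : ∑ k ∈ Finset.range μ, (boundaryWeight μ ν n k : ℂ) / (ω : ℂ) ^ k *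
      iteratedDeriv k f 0 = ∑ k ∈ Finset.range (4 * n + kappaNat μ ν), p.coeff k *
        (((if k < μ then (k.factorial : ℝ) * boundaryWeight μ ν n k else 0 : ℝ) : ℂ) /
          (ω : ℂ) ^ k) := by
    rw [← Finset.sum_subset hsub (fun k _ hk => by
      rw [if_neg (by simpa using hk)]
      simp)]
    refine Finset.sum_congr rfl fun k hk => ?_
    rw [if_pos (Finset.mem_range.1 hk), hf0.iteratedDeriv_eq, iteratedDeriv_eval_zero]
    push_cast
    ring
  have hi : ∀ x ∈ gaussNodes (weight μ ν) n,
      interiorWeight μ ν n 1 x * f (Complex.I * (√x : ℂ) / (ω : ℂ)) +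
        interiorWeight μ ν n (-1) x * f (-(Complex.I * (√x : ℂ)) / (ω : ℂ)) =
      ∑ k ∈ Finset.range (4 * n + kappaNat μ ν), p.coeff k *
        (((2 / Real.pi * Real.cos (((k : ℝ) - ν) * Real.pi / 2) *
          (gaussWeight (weight μ ν) n x * x ^ (((k : ℝ) - kappa μ ν) / 2)) : ℝ) : ℂ) /
            (ω : ℂ) ^ k) := by
    intro x hx
    -- The nodes lie on the imaginary axis, the boundary of the half-plane where `f = p`.
    rw [hf (by simp [Complex.div_ofReal_re]), hf (by simp [Complex.div_ofReal_re])]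
    simp only
    rw [Polynomial.eval_eq_sum_range' hp, Polynomial.eval_eq_sum_range' hp, Finset.mul_sum,
      Finset.mul_sum, ← Finset.sum_add_distrib]
    refine Finset.sum_congr rfl fun k _ => ?_
    rw [← interiorWeight_mul_pow_add μ ν n k (pos_of_mem_gaussNodes_weight h hx)]
    ring
  rw [rule, hb, Finset.sum_congr rfl hi, Finset.sum_comm, ← Finset.sum_add_distrib, Finset.mul_sum]
  refine Finset.sum_congr rfl fun k hk => ?_
  rw [← ite_boundaryWeight_add h hn (Finset.mem_range.1 hk), ← Finset.mul_sum, ← Finset.sum_div,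
    ← Complex.ofReal_sum, ← Finset.mul_sum]
  push_cast
  ring

lemma HasAbelIntegral.const_mul {g : ℝ → ℂ} {L : ℂ} (hg : HasAbelIntegral g L) (c : ℂ) :
    HasAbelIntegral (fun x => c * g x) (c * L) := by
  refine ⟨fun s hs => ?_, ?_⟩
  · simpa only [mul_assoc] using! (hg.1 s hs).const_mul c
  · simpa only [mul_assoc, integral_const_mul] using hg.2.const_mul c

lemma HasAbelIntegral.sum {ι : Type*} {S : Finset ι} {g : ι → ℝ → ℂ} {L : ι → ℂ}
    (hg : ∀ i ∈ S, HasAbelIntegral (g i) (L i)) :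
    HasAbelIntegral (fun x => ∑ i ∈ S, g i x) (∑ i ∈ S, L i) := by
  refine ⟨fun s hs => ?_, ?_⟩
  · simp only [Finset.sum_mul]
    exact integrable_finsetSum _ fun i hi => (hg i hi).1 s hs
  · refine (tendsto_finsetSum _ fun i hi => (hg i hi).2).congr' ?_
    filter_upwards [self_mem_nhdsWithin] with s hs
    simp only [Finset.sum_mul]
    exact (integral_finsetSum _ fun i hi => (hg i hi).1 s hs).symm

lemma HasAbelIntegral.congr {g g' : ℝ → ℂ} {L : ℂ} (hg : HasAbelIntegral g L)
    (h : ∀ x, 0 < x → g x = g' x) : HasAbelIntegral g' L := by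
  have heq : ∀ s : ℝ, EqOn (fun x : ℝ => g x * (Real.exp (-s * x) : ℂ))
      (fun x : ℝ => g' x * (Real.exp (-s * x) : ℂ)) (Ioi 0) := fun s x hx => by
    simp only [h x hx]
  refine ⟨fun s hs => (hg.1 s hs).congr_fun (heq s) measurableSet_Ioi, hg.2.congr fun s => ?_⟩
  exact setIntegral_congr_fun measurableSet_Ioi (heq s)

lemma hasAbelIntegral_pow_mul_besselJ (k ν : ℕ) {ω : ℝ} (hω : 0 < ω) :
    HasAbelIntegral (fun x : ℝ => (x : ℂ) ^ k * (besselJ ν (ω * x) : ℂ))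
      ((besselMoment k ν / ω ^ (k + 1) : ℝ) : ℂ) := by
  have hfun : ∀ s x : ℝ, (x : ℂ) ^ k * (besselJ ν (ω * x) : ℂ) * (Real.exp (-s * x) : ℂ) =
      (((ω ^ k)⁻¹ * ((ω * x) ^ k * besselJ ν (ω * x) * Real.exp (-(s / ω) * (ω * x))) : ℝ) : ℂ) :=
    fun s x => by
      rw [show -(s / ω) * (ω * x) = -s * x by field_simp, mul_pow]
      have hω' : (ω : ℂ) ≠ 0 := Complex.ofReal_ne_zero.2 hω.ne'
      push_cast
      field_simp
  simp only [HasAbelIntegral, hfun]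
  constructor
  · intro s hs
    have h := (integrableOn_Ioi_comp_mul_left_iff
      (fun y => y ^ k * besselJ ν y * Real.exp (-(s / ω) * y)) 0 hω).2
      (by rw [mul_zero]; exact integrableOn_besselLaplace k ν (div_pos hs hω))
    exact (h.const_mul _).ofReal
  · have hlim : Tendsto (fun s : ℝ => s / ω) (𝓝[>] 0) (𝓝[>] 0) := by
      refine tendsto_nhdsWithin_iff.2 ⟨?_, ?_⟩
      · simpa using (tendsto_nhdsWithin_of_tendsto_nhds
          (tendsto_id (α := ℝ) (x := 𝓝 0)) (s := Ioi 0)).div_const ω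
      · filter_upwards [self_mem_nhdsWithin] with s hs
        exact div_pos hs hω
    have h := (((tendsto_besselLaplace k ν).comp hlim).div_const (ω ^ (k + 1))).ofReal
    refine h.congr fun s => ?_
    rw [integral_complex_ofReal, integral_const_mul, integral_comp_mul_left_Ioi
      (fun y => y ^ k * besselJ ν y * Real.exp (-(s / ω) * y)) 0 hω, mul_zero]
    simp only [Function.comp_apply, besselLaplace, smul_eq_mul, pow_succ]
    congr 1
    field_simp

/-- The half-plane is no neighbourhood of `0`, so `f = p` near `0` takes the identity theorem:
the derivatives of `f` at `0` in the rule are those of `p`. -/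
lemma eventuallyEq_of_eqOn_re_nonneg {f : ℂ → ℂ} {p : ℂ[X]} (ha : AnalyticAt ℂ f 0)
    (hf : EqOn f (fun z => p.eval z) {z : ℂ | 0 ≤ z.re}) : f =ᶠ[𝓝 0] fun z => p.eval z := by
  refine (ha.frequently_eq_iff_eventually_eq
    ((Polynomial.differentiable p).analyticAt 0)).1 ?_
  have hlim : Tendsto (fun t : ℝ => (t : ℂ)) (𝓝[>] 0) (𝓝[≠] 0) := by
    refine tendsto_nhdsWithin_iff.2 ⟨?_, ?_⟩
    · exact tendsto_nhdsWithin_of_tendsto_nhds (Complex.continuous_ofReal.tendsto' 0 0 (by simp))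
    · filter_upwards [self_mem_nhdsWithin] with t ht
      simpa using (mem_Ioi.1 ht).ne'
  refine hlim.frequently (Eventually.frequently ?_)
  filter_upwards [self_mem_nhdsWithin] with t ht
  exact hf (by simpa using (mem_Ioi.1 ht).le)

/-- Exactness of the rule for polynomials of degree below `4n + κ`. -/
lemma hasAbelIntegral_rule {μ ν n : ℕ} (h : ν ≤ μ) (hn : 1 ≤ n) {f : ℂ → ℂ} {p : ℂ[X]}
    (ha : AnalyticAt ℂ f 0) (hp : p.natDegree < 4 * n + kappaNat μ ν)
    (hf : EqOn f (fun z => p.eval z) {z : ℂ | 0 ≤ z.re}) {ω : ℝ} (hω : 0 < ω) :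
    HasAbelIntegral (fun x : ℝ => f x * (besselJ ν (ω * x) : ℂ)) (rule μ ν n f ω) := by
  rw [rule_eq_sum h hn hp hf (eventuallyEq_of_eqOn_re_nonneg ha hf)]
  refine (HasAbelIntegral.sum fun k _ =>
    (hasAbelIntegral_pow_mul_besselJ k ν hω).const_mul (p.coeff k)).congr fun x hx => ?_
  rw [hf (by simpa using hx.le)]
  simp only
  rw [Polynomial.eval_eq_sum_range' hp, Finset.sum_mul]
  exact Finset.sum_congr rfl fun k _ => by ring

end HankelRule

theorem mainTheorem2 (ν μ n : ℕ) (hνμ : ν ≤ μ) (hn : 1 ≤ n) :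
    -- the nodes and weights in the rule are those of the `n`-point Gauss rule for the weight
    (((HankelRule.gaussNodes (HankelRule.weight μ ν) n).card = n ∧
      (∀ x ∈ HankelRule.gaussNodes (HankelRule.weight μ ν) n, 0 < x) ∧
      ∀ p ∈ Polynomial.degreeLE ℝ ((2 * n - 1 : ℕ) : WithBot ℕ),
        IntegrableOn (fun x : ℝ => HankelRule.weight μ ν x * p.eval x) (Ioi 0) ∧
        ∫ x in Ioi (0 : ℝ), HankelRule.weight μ ν x * p.eval x =
          ∑ x ∈ HankelRule.gaussNodes (HankelRule.weight μ ν) n,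
            HankelRule.gaussWeight (HankelRule.weight μ ν) n x * p.eval x)) ∧
    -- exactness of the rule for the Hankel transform
    ∀ f : ℂ → ℂ,
      AnalyticOnNhd ℂ f {z : ℂ | 0 < z.re} →
      AnalyticAt ℂ f 0 →
      (∃ σ C R : ℝ, ∀ z : ℂ, 0 < z.re → R ≤ ‖z‖ → ‖f z‖ ≤ C * ‖z‖ ^ σ) →
      (Even (μ - ν) →
        (∃ p ∈ Polynomial.degreeLE ℂ ((4 * n + μ - 1 : ℕ) : WithBot ℕ),
          EqOn f (fun z => p.eval z) {z : ℂ | 0 ≤ z.re}) →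
        ∀ ω : ℝ, 0 < ω →
          HankelRule.HasAbelIntegral (fun x : ℝ => f x * (HankelRule.besselJ ν (ω * x) : ℂ))
            (HankelRule.rule μ ν n f ω)) ∧
      (Odd (μ - ν) →
        (∃ p ∈ Polynomial.degreeLE ℂ ((4 * n + μ : ℕ) : WithBot ℕ),
          EqOn f (fun z => p.eval z) {z : ℂ | 0 ≤ z.re}) →
        ∀ ω : ℝ, 0 < ω →
          HankelRule.HasAbelIntegral (fun x : ℝ => f x * (HankelRule.besselJ ν (ω * x) : ℂ))
            (HankelRule.rule μ ν n f ω)) := by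
  have hint := HankelRule.integrableOn_weight_mul_eval hνμ
  have hpos : ∀ x, 0 < x → 0 < HankelRule.weight μ ν x := fun _ => HankelRule.weight_pos μ ν
  refine ⟨⟨HankelRule.card_gaussNodes hint hpos n,
    fun x hx => HankelRule.pos_of_mem_gaussNodes hint hpos hx, fun p hp => ⟨hint p, ?_⟩⟩, ?_⟩
  · rw [Polynomial.mem_degreeLE] at hp
    exact HankelRule.gauss_rule_weight hνμ hn (Polynomial.natDegree_le_of_degree_le hp)
  intro f _ ha _
  refine ⟨fun he => ?_, fun ho => ?_⟩ <;>
  · rintro ⟨p, hp, hf⟩ ω hω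
    rw [Polynomial.mem_degreeLE] at hp
    have hd := Polynomial.natDegree_le_of_degree_le hp
    refine HankelRule.hasAbelIntegral_rule hνμ hn ha ?_ hf hω
    first
    | rw [HankelRule.kappaNat, if_pos he]; omega
    | rw [HankelRule.kappaNat, if_neg (Nat.not_even_iff_odd.2 ho)]; omega
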